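/- \textbf{Theorem.} For $E\subseteq\mathbb{R}$ and $\rho>0$, let $V_n=[-e^n,e^n)$ and $S_{n}=V_{n}\setminus V_{n-1}$ for integers $n\ge1$, and let $\nu^n_\rho(E)=\inf\sum_{i=1}^m(r_i/e^n)^\rho$, where the infimum is over all finite families of intervals $[x_i,x_i+r_i)$ with $r_i\ge 1$ that cover $E\cap S_n$. The (Barlow--Taylor) macroscopic Hausdorff dimension of $E$ is $\mathrm{Dim}\,E=\inf\{\rho>0:\sum_{n=1}^\infty\nu^n_\rho(E)<\infty\}$. Let $B=\{B(t)\}_{t\ge0}$ be a standard one-dimensional Brownian motion and let $U(t)=e^{-t/2}B(e^t)$, an Ornstein--Uhlenbeck process. Then, for every $\gamma>0$, almost surely $$\mathrm{Dim}\left\{s\ge e^e:\ \frac{B(s)}{(2s\log\log s)^{1/2}}\ge\gamma\right\}=\begin{cases}1&\text{if }\gamma\le1,\\0&\text{if }\gamma>1,\end{cases}$$ and almost surely $$\mathrm{Dim}\left\{s\ge e^e:\ \frac{U(s)}{(2\log s)^{1/2}}\ge\gamma\right\}=1-\gamma^2\quad\text{if }\gamma\le1,$$ while the latter set is bounded if $\gamma>1$.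 Moreover, the tall peaks of $B$ are monofractal and those of $U$ are multifractal, in the following sense. Let $\log_+x=\max(\log x,0)$ (with $\log_+0=0$), $g_B(s)=(2s\log_+\log_+s)^{1/2}$ and $g_U(s)=(2\log_+s)^{1/2}$. For $(X,g)=(B,g_B)$ and $(X,g)=(U,g_U)$, $g$ is a gauge function for $X$, that is, $g$ is nonnegative and nondecreasing on $[0,\infty)$, $g(t)\to\infty$ and $\limsup_{t\to\infty}|X(t)|/g(t)=1$ almost surely. For $c_0,\gamma>0$ put $\mathcal{P}_X(\gamma)=\{t>c_0:|X(t)|/g(t)>\gamma\}$ (a quotient with $g(t)=0$ being read as $0$). Then for every $c_0>0$: almost surely, $\mathrm{Dim}\,\mathcal{P}_B(\gamma)=1$ for all $\gamma\in(0,1)$ and $\mathrm{Dim}\,\mathcal{P}_B(\gamma)=0$ for all $\gamma>1$; and there are nonrandom $\gamma_1>\gamma_2>\cdots>0$ such that almost surely $\mathrm{Dim}\,\mathcal{P}_U(\gamma_i)<\mathrm{Dim}\,\mathcal{P}_U(\gamma_{i+1})$ for all $i\ge1$. -/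

import Mathlib

open MeasureTheory ProbabilityTheory Filter Set
open scoped NNReal ENNReal

namespace MacroFractal

/-- The interval `V_n = [-e^n, e^n)`. -/
def window (n : ℕ) : Set ℝ := Ico (-Real.exp n) (Real.exp n)

/-- The `n`-th shell of the real line: `S_0 = V_0` and `S_{n+1} = V_{n+1} \ V_n`. -/
def shell : ℕ → Set ℝ
  | 0 => window 0
  | n + 1 => window (n + 1) \ window n

/-- The scaled `ρ`-dimensional Hausdorff content `ν^n_ρ(E)` of `E` on the `n`-th shell: the infimum
of `∑ i, (r i / e^n)^ρ` over all finite families (possibly empty) of upright boxes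
`[x i, x i + r i)` with side `r i ≥ 1` which cover `E ∩ S_n`. -/
noncomputable def shellContent (n : ℕ) (ρ : ℝ) (E : Set ℝ) : ℝ≥0∞ :=
  ⨅ (m : ℕ) (x : Fin m → ℝ) (r : Fin m → ℝ) (_ : ∀ i, 1 ≤ r i)
    (_ : E ∩ shell n ⊆ ⋃ i, Ico (x i) (x i + r i)),
    ∑ i, ENNReal.ofReal ((r i / Real.exp n) ^ ρ)

/-- The Barlow-Taylor macroscopic Hausdorff dimension of a set `E ⊆ ℝ`: the infimum of all `ρ > 0`
such that `∑_{n ≥ 1} ν^n_ρ(E) < ∞`. -/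
noncomputable def macroDim (E : Set ℝ) : ℝ≥0∞ :=
  ⨅ (ρ : ℝ) (_ : 0 < ρ) (_ : ∑' n : ℕ, shellContent (n + 1) ρ E < ∞), ENNReal.ofReal ρ

variable {Ω : Type*} {mΩ : MeasurableSpace Ω}

/-- The process `U(t) = e^{-t/2} B(e^t)`, for real `t`. -/
noncomputable def ouProcess (B : ℝ≥0 → Ω → ℝ) (t : ℝ) (ω : Ω) : ℝ :=
  Real.exp (-t / 2) * B (Real.exp t).toNNReal ω

/-- `g : ℝ₊ → ℝ₊` is a gauge function for the process `X`: it is nonrandom, increasing, tends to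
infinity, and `limsup_{t → ∞} |X(t)| / g(t) = 1` almost surely. -/
structure IsGauge (g : ℝ → ℝ) (X : ℝ → Ω → ℝ) (P : Measure Ω) : Prop where
  nonneg : ∀ t, 0 ≤ t → 0 ≤ g t
  monotoneOn : MonotoneOn g (Ici 0)
  tendsto : Tendsto g atTop atTop
  limsup_eq : ∀ᵐ ω ∂P, limsup (fun t : ℝ => ((|X t ω| / g t : ℝ) : EReal)) atTop = 1

/-- The tall peaks of `X` (beyond `c₀`) in length scale `γ`. -/
def tallPeaks (g : ℝ → ℝ) (X : ℝ → Ω → ℝ) (c₀ γ : ℝ) (ω : Ω) : Set ℝ :=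
  {t : ℝ | c₀ < t ∧ γ < |X t ω| / g t}

/-- The tall peaks of `X`, measured by the gauge function `g`, are monofractal. -/
def IsMonofractal (g : ℝ → ℝ) (X : ℝ → Ω → ℝ) (c₀ : ℝ) (P : Measure Ω) : Prop :=
  IsGauge g X P ∧
    ∀ᵐ ω ∂P, ∀ γ : ℝ, 0 < γ →
      (γ < 1 → macroDim (tallPeaks g X c₀ γ ω) = 1) ∧
      (1 < γ → macroDim (tallPeaks g X c₀ γ ω) = 0)

/-- The tall peaks of `X`, measured by the gauge function `g`, are multifractal: along some
nonrandom sequence of length scales decreasing in `(0, ∞)`, the dimensions of the (increasing)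
sets of tall peaks are almost surely strictly increasing. -/
def IsMultifractal (g : ℝ → ℝ) (X : ℝ → Ω → ℝ) (c₀ : ℝ) (P : Measure Ω) : Prop :=
  IsGauge g X P ∧
    ∃ γ : ℕ → ℝ, StrictAnti γ ∧ (∀ i, 0 < γ i) ∧
      ∀ᵐ ω ∂P, ∀ i, macroDim (tallPeaks g X c₀ (γ i) ω) <
        macroDim (tallPeaks g X c₀ (γ (i + 1)) ω)

end MacroFractal

namespace MacroFractal

/-! ### Deterministic estimates of contents and of the macroscopic dimension -/

/-! The process `U` is Brownian motion on the logarithmic time scale: it is stationary, with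
standard normal marginals and correlations `e^{-|u-v|/2}`. Near time `s` it exceeds `γ √(2 log s)`
with probability `s^{-γ²+o(1)}`, so the `n`-th shell should contain about `e^{(1-γ²)n}` unit
intervals with a peak, spread out evenly. This explains `1 - γ²`.

Upper bounds are first moment estimates. Lévy's maximal inequality on short pieces of `[k, k+1]`
gives `P(tall on [k, k+1]) ≤ C (k+1)^{-β}` for every `β < γ²` (`exists_measure_tallEvent_le`). If `γ
> 1`, Borel-Cantelli makes the peaks bounded (`eventually_abs_ouProcess_lt`). If `γ ≤ 1`, covering
the peaks by unit intervals gives contents of expectation `O(e^{(1-β-ρ)n})`, summable when `ρ > 1 -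
β` (`macroDim_le_of_lt`).

Lower bounds replace `U` by independent increments. Over a time lag `g` the old value of `U` is
damped by `e^{-g/2}`, so a large increment of `B` forces a peak. For `θ > γ²` the `n`-th shell is
cut into cells of length about `n e^{θn}`, each holding `e^{θn}` increments with lag `n`. Each is
large with probability at least `e^{-κn}`, where `γ² < κ < θ`, so a union bound over cells shows
that all of them eventually contain a peak (`eventually_exists_increment`). Points in all cells keep
the content bounded below for `ρ < 1 - θ`, by counting (`le_shellContent_of_cells`, `le_macroDim`).

For `B` itself, one shell is a unit interval for `U` in logarithmic time, so a single peak fills a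
positive proportion of a shell. At the critical level, widely separated shells are observed and `B`
is compared with its value at an earlier reference time. The expected proportion of tall integer
times is at least `c / (k log k)`, a divergent series, and the proportions are independent; hence
their sum diverges almost surely, which forces dimension one (`ae_tsum_obsProportion`,
`one_le_macroDim`). The gauge property and both fractality statements follow from these bounds. The
almost sure bounds quantify over all sets `E` inside the event, so that they apply to random sets.
-/

lemma shellContent_le_sum {ι : Type*} (s : Finset ι) (x r : ι → ℝ) (hr : ∀ i ∈ s, 1 ≤ r i)
    {n : ℕ} {ρ : ℝ} {E : Set ℝ} (hcov : E ∩ shell n ⊆ ⋃ i ∈ s, Ico (x i) (x i + r i)) :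
    shellContent n ρ E ≤ ∑ i ∈ s, ENNReal.ofReal ((r i / Real.exp n) ^ ρ) := by
  let e := s.equivFin.symm
  refine iInf_le_of_le s.card <| iInf_le_of_le (fun i => x (e i)) <|
    iInf_le_of_le (fun i => r (e i)) <| iInf_le_of_le (fun i => hr _ (e i).2) <|
    iInf_le_of_le ?_ ?_
  · intro y hy
    obtain ⟨i, hi, hyi⟩ := mem_iUnion₂.1 (hcov hy)
    refine mem_iUnion.2 ⟨s.equivFin ⟨i, hi⟩, ?_⟩
    simpa [e] using hyi
  · rw [← Finset.sum_coe_sort s (fun i => ENNReal.ofReal ((r i / Real.exp n) ^ ρ)),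
      ← e.sum_comp]

lemma shell_subset_window (n : ℕ) : shell n ⊆ window n := by
  cases n with
  | zero => exact subset_rfl
  | succ n => exact sdiff_subset.trans (by simp)

lemma shellContent_lt_top (n : ℕ) (ρ : ℝ) (E : Set ℝ) : shellContent n ρ E < ∞ := by
  have h1 : 1 ≤ Real.exp n := Real.one_le_exp (by positivity)
  refine (shellContent_le_sum (Finset.univ : Finset Unit) (fun _ => -Real.exp n)
    (fun _ => 2 * Real.exp n) (fun _ _ => by linarith) ?_).trans_lt ?_
  · intro y hy
    have := shell_subset_window n hy.2
    simp only [window, mem_Ico] at this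
    simp only [Finset.mem_univ, iUnion_true, mem_iUnion, mem_Ico, exists_const]
    constructor <;> linarith [this.1, this.2]
  · simp

lemma tsum_add_le_tsum (N : ℕ) (a : ℕ → ℝ≥0∞) : ∑' n, a (n + N) ≤ ∑' n, a n :=
  ENNReal.tsum_comp_le_tsum_of_injective (f := fun n => n + N) (add_left_injective N) a

lemma tsum_nat_add_eq_top (N : ℕ) {a : ℕ → ℝ≥0∞} (ha : ∀ n, a n ≠ ∞) (h : ∑' n, a n = ∞) :
    ∑' n, a (n + N) = ∞ := by
  have h1 := Summable.sum_add_tsum_nat_add' (f := a) (k := N) ENNReal.summable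
  rw [h, ENNReal.add_eq_top] at h1
  exact h1.resolve_left (ENNReal.sum_lt_top.2 fun i _ => (ha i).lt_top).ne

lemma macroDim_le_of_tsum {E : Set ℝ} {ρ : ℝ} (hρ : 0 < ρ) (a : ℕ → ℝ≥0∞)
    (ha : ∑' n, a n ≠ ∞) (h : ∀ᶠ n : ℕ in atTop, shellContent (n + 1) ρ E ≤ a n) :
    macroDim E ≤ ENNReal.ofReal ρ := by
  refine iInf_le_of_le ρ <| iInf_le_of_le hρ <| iInf_le_of_le ?_ le_rfl
  obtain ⟨N, hN⟩ := eventually_atTop.1 h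
  by_contra hcon
  have htop := tsum_nat_add_eq_top N (a := fun n => shellContent (n + 1) ρ E)
    (fun n => (shellContent_lt_top _ _ _).ne) (not_lt_top_iff.1 hcon)
  refine absurd htop (ne_of_lt ?_)
  refine (ENNReal.tsum_le_tsum fun n => hN (n + N) (by omega)).trans_lt ?_
  exact (tsum_add_le_tsum N a).trans_lt ha.lt_top

lemma le_macroDim_of_tsum {E : Set ℝ} {d : ℝ}
    (h : ∀ ρ, 0 < ρ → ρ < d → ∑' n, shellContent (n + 1) ρ E = ∞) :
    ENNReal.ofReal d ≤ macroDim E := by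
  refine le_iInf fun ρ => le_iInf fun hρ => le_iInf fun hs => ?_
  refine ENNReal.ofReal_le_ofReal ?_
  by_contra! hlt
  exact hs.ne (h ρ hρ hlt)

lemma macroDim_eq_zero_of_isBounded {E : Set ℝ} (h : Bornology.IsBounded E) : macroDim E = 0 := by
  obtain ⟨R, hR⟩ := h.exists_norm_le
  refine le_antisymm (ENNReal.le_of_forall_pos_le_add fun ε hε _ => ?_) bot_le
  rw [zero_add, ← ENNReal.ofReal_coe_nnreal]
  refine macroDim_le_of_tsum (by exact_mod_cast hε) (fun _ => 0) (by simp) ?_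
  have h1 : ∀ᶠ n : ℕ in atTop, R < Real.exp n :=
    (Real.tendsto_exp_atTop.comp tendsto_natCast_atTop_atTop).eventually_gt_atTop R
  filter_upwards [h1] with n hn
  -- Shells beyond the bound `R` miss the set, and the empty family is an admissible cover with
  -- content `0`.
  refine (shellContent_le_sum (∅ : Finset Unit) (fun _ => 0) (fun _ => 1) (by simp) ?_).trans
    (by simp)
  rintro y ⟨hy, hys⟩
  have := hR y hy
  rw [Real.norm_eq_abs, abs_le] at this
  exact absurd ⟨by linarith [this.1], by linarith [this.2]⟩ hys.2

lemma shellContent_le_card {ι : Type*} (s : Finset ι) (x : ι → ℝ)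
    {n : ℕ} {ρ : ℝ} {E : Set ℝ} (hcov : E ∩ shell n ⊆ ⋃ i ∈ s, Ico (x i) (x i + 1)) :
    shellContent n ρ E ≤ s.card * ENNReal.ofReal (Real.exp (-(n * ρ))) := by
  refine (shellContent_le_sum s x (fun _ => 1) (by simp) hcov).trans ?_
  rw [Finset.sum_const, nsmul_eq_mul, one_div, Real.inv_rpow (Real.exp_pos _).le,
    ← Real.exp_mul, Real.exp_neg]

lemma tsum_ofReal_exp_mul_ne_top (C : ℝ) {c : ℝ} (hc : c < 0) :
    ∑' n : ℕ, ENNReal.ofReal (C * Real.exp (c * n)) ≠ ∞ := by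
  have : Summable fun n : ℕ => C * Real.exp (c * n) :=
    ((Real.summable_exp_nat_mul_iff.2 hc).congr (fun n => by rw [mul_comm])).mul_left C
  exact this.tsum_ofReal_ne_top

/-- The whole shell is covered by at most `5 e^{n+1}` unit intervals with integer endpoints, so its
content at exponent `1 + ε` decays like `e^{-εn}`. -/
lemma macroDim_le_one (E : Set ℝ) : macroDim E ≤ 1 := by
  refine ENNReal.le_of_forall_pos_le_add fun ε hε _ => ?_
  have hε' : (0 : ℝ) < ε := by exact_mod_cast hε
  have : (1 : ℝ≥0∞) + ε = ENNReal.ofReal (1 + ε) := by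
    rw [ENNReal.ofReal_add zero_le_one hε'.le]; simp
  rw [this]
  refine macroDim_le_of_tsum (by positivity) _
    (tsum_ofReal_exp_mul_ne_top (5 * Real.exp (-ε)) (neg_lt_zero.2 hε')) (.of_forall fun n => ?_)
  have h1 : 1 ≤ Real.exp (n + 1 : ℕ) := Real.one_le_exp (by positivity)
  refine (shellContent_le_card (Finset.Icc (-⌈Real.exp (n + 1 : ℕ)⌉) ⌈Real.exp (n + 1 : ℕ)⌉)
    (fun k : ℤ => (k : ℝ)) ?_).trans ?_
  · rintro y ⟨-, hy⟩
    have hw := shell_subset_window _ hy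
    simp only [window, mem_Ico] at hw
    refine mem_iUnion₂.2 ⟨⌊y⌋, ?_, Int.floor_le y, Int.lt_floor_add_one y⟩
    rw [Finset.mem_Icc]
    constructor
    · rw [Int.le_floor]
      have := Int.le_ceil (Real.exp (n + 1 : ℕ))
      push_cast at *
      linarith
    · have := Int.floor_le y
      have h2 := Int.le_ceil (Real.exp (n + 1 : ℕ))
      exact_mod_cast this.trans (hw.2.le.trans h2)
  · rw [Int.card_Icc, ← ENNReal.ofReal_natCast, ← ENNReal.ofReal_mul (by positivity)]
    refine ENNReal.ofReal_le_ofReal ?_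
    have h2 := Int.ceil_lt_add_one (Real.exp (n + 1 : ℕ))
    have h3 : (0 : ℝ) ≤ ⌈Real.exp (n + 1 : ℕ)⌉ := by
      exact_mod_cast Int.ceil_nonneg (Real.exp_pos _).le
    have h4 : ((⌈Real.exp (n + 1 : ℕ)⌉ + 1 - -⌈Real.exp (n + 1 : ℕ)⌉).toNat : ℝ)
        ≤ 5 * Real.exp (n + 1 : ℕ) := by
      have : ((⌈Real.exp (n + 1 : ℕ)⌉ + 1 - -⌈Real.exp (n + 1 : ℕ)⌉).toNat : ℤ)
        = 2 * ⌈Real.exp (n + 1 : ℕ)⌉ + 1 := by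
        rw [Int.toNat_of_nonneg]
        · ring
        · have : 0 ≤ ⌈Real.exp (n + 1 : ℕ)⌉ := by exact_mod_cast h3
          omega
      have h5 : (((⌈Real.exp (n + 1 : ℕ)⌉ + 1 - -⌈Real.exp (n + 1 : ℕ)⌉).toNat : ℤ) : ℝ)
        = 2 * ⌈Real.exp (n + 1 : ℕ)⌉ + 1 := by rw [this]; push_cast; ring
      rw [Int.cast_natCast] at h5
      rw [h5]; linarith
    refine (mul_le_mul_of_nonneg_right h4 (Real.exp_pos _).le).trans ?_
    rw [mul_assoc, ← Real.exp_add, mul_assoc, ← Real.exp_add]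
    refine le_of_eq ?_
    push_cast
    ring_nf

/-- This is the mass distribution principle for the counting measure of finitely many points: if no
interval carries more than `K` times its cost, then every cover costs at least the total mass over
`K`. -/
lemma le_shellContent_of_count {ι : Type*} {n : ℕ} {ρ K : ℝ} {E : Set ℝ} (A : Finset ι)
    (p : ι → ℝ) (hp : ∀ a ∈ A, p a ∈ E ∩ shell n) (hK : 0 < K)
    (h : ∀ x r : ℝ, 1 ≤ r →
      ((A.filter fun a => p a ∈ Ico x (x + r)).card : ℝ) ≤ K * (r / Real.exp n) ^ ρ) :
    ENNReal.ofReal (A.card / K) ≤ shellContent n ρ E := by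
  classical
  refine le_iInf fun m => le_iInf fun x => le_iInf fun r => le_iInf fun hr => le_iInf fun hc => ?_
  have hpos : ∀ i, 0 ≤ (r i / Real.exp n) ^ ρ := fun i =>
    Real.rpow_nonneg (div_nonneg (by linarith [hr i]) (Real.exp_pos _).le) _
  rw [← ENNReal.ofReal_sum_of_nonneg fun i _ => hpos i]
  refine ENNReal.ofReal_le_ofReal ?_
  rw [div_le_iff₀' hK, Finset.mul_sum]
  have hsub : A ⊆ Finset.univ.biUnion fun i => A.filter fun a => p a ∈ Ico (x i) (x i + r i) := by
    intro a ha
    obtain ⟨i, hi⟩ := mem_iUnion.1 (hc (hp a ha))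
    exact Finset.mem_biUnion.2 ⟨i, Finset.mem_univ _, Finset.mem_filter.2 ⟨ha, hi⟩⟩
  calc (A.card : ℝ) ≤ ∑ i, ((A.filter fun a => p a ∈ Ico (x i) (x i + r i)).card : ℝ) := by
        exact_mod_cast (Finset.card_le_card hsub).trans Finset.card_biUnion_le
    _ ≤ _ := Finset.sum_le_sum fun i _ => h _ _ (hr i)

lemma mem_shell_succ {n : ℕ} {s : ℝ} (h1 : Real.exp n ≤ s) (h2 : s < Real.exp (n + 1 : ℕ)) :
    s ∈ shell (n + 1) := by
  refine ⟨⟨?_, h2⟩, fun h => ?_⟩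
  · linarith [Real.exp_pos n, Real.exp_pos (n + 1 : ℕ)]
  · exact absurd h.2 (by push Not; exact h1)

/-- An interval of length `r` meets at most `r / L + 2` cells, the `2` accounting for the cells at
its ends. -/
lemma card_filter_cells_le {L : ℝ} (hL : 0 < L) (A : Finset ℕ) (p : ℕ → ℝ)
    (hp : ∀ a ∈ A, a * L ≤ p a ∧ p a < (a + 1) * L) (x r : ℝ) (hr : 0 ≤ r) :
    ((A.filter fun a => p a ∈ Ico x (x + r)).card : ℝ) ≤ r / L + 2 := by
  have hsub : (A.filter fun a => p a ∈ Ico x (x + r)).map ⟨((↑) : ℕ → ℤ), Nat.cast_injective⟩ ⊆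
      Finset.Ico ⌊x / L⌋ ⌈(x + r) / L⌉ := by
    intro b hb
    obtain ⟨a, ha, rfl⟩ := Finset.mem_map.1 hb
    obtain ⟨haA, h1, h2⟩ := Finset.mem_filter.1 ha
    obtain ⟨h3, h4⟩ := hp a haA
    simp only [Function.Embedding.coeFn_mk, Finset.mem_Ico]
    constructor
    · have : x / L < ((a + 1 : ℤ) : ℝ) := by
        rw [div_lt_iff₀ hL]; push_cast; linarith
      have := Int.floor_lt.2 this
      omega
    · rw [Int.lt_ceil, lt_div_iff₀ hL]; push_cast; linarith
  have h1 := Finset.card_le_card hsub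
  rw [Finset.card_map, Int.card_Ico] at h1
  have h2 : (⌈(x + r) / L⌉ - ⌊x / L⌋ : ℝ) ≤ r / L + 2 := by
    have := Int.ceil_lt_add_one ((x + r) / L)
    have := Int.sub_one_lt_floor (x / L)
    have : (x + r) / L = x / L + r / L := by ring
    linarith
  refine (Nat.cast_le.2 h1).trans ?_
  rcases le_total 0 (⌈(x + r) / L⌉ - ⌊x / L⌋) with h | h
  · have : (((⌈(x + r) / L⌉ - ⌊x / L⌋).toNat : ℤ) : ℝ) = ⌈(x + r) / L⌉ - ⌊x / L⌋ := by
      rw [Int.toNat_of_nonneg h]; push_cast; ring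
    rw [Int.cast_natCast] at this
    rw [this]; exact h2
  · rw [Int.toNat_of_nonpos h]; push_cast; positivity

/-- Points of `E` in distinct cells of length `L` bound the content from below. -/
lemma le_shellContent_of_cells {n : ℕ} {ρ L N : ℝ} {E : Set ℝ} (hρ : 0 < ρ) (hρ1 : ρ ≤ 1)
    (hL : 0 < L) (hN1 : Real.exp (n + 1 : ℕ) / L ≤ N) (hN2 : Real.exp (n + 1 : ℕ) ^ ρ ≤ N)
    (A : Finset ℕ) (p : ℕ → ℝ) (hp : ∀ a ∈ A, a * L ≤ p a ∧ p a < (a + 1) * L)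
    (hE : ∀ a ∈ A, p a ∈ E)
    (hs : ∀ a ∈ A, Real.exp n ≤ p a ∧ p a < Real.exp (n + 1 : ℕ)) :
    ENNReal.ofReal (A.card / (3 * N)) ≤ shellContent (n + 1) ρ E := by
  set e := Real.exp (n + 1 : ℕ) with he
  have he0 : 0 < e := Real.exp_pos _
  have hN : 0 < N := lt_of_lt_of_le (by positivity) hN2
  refine le_shellContent_of_count A p
    (fun a ha => ⟨hE a ha, mem_shell_succ (hs a ha).1 (hs a ha).2⟩) (by positivity) ?_
  intro x r hr
  rw [← he]
  rcases le_total r e with hre | hre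
  -- For `r ≤ e`, both `r / L` and `1` are at most `N (r / e)^ρ`: the former by `hN1` and `ρ ≤ 1`,
  -- the latter by `hN2` and `r ≥ 1`. Hence the factor `3`.
  · refine (card_filter_cells_le hL A p hp x r (by linarith)).trans ?_
    have h1 : r / e ≤ (r / e) ^ ρ := by
      conv_lhs => rw [← Real.rpow_one (r / e)]
      exact Real.rpow_le_rpow_of_exponent_ge (by positivity) ((div_le_one he0).2 hre) hρ1
    have h2 : r / L ≤ N * (r / e) ^ ρ := by
      calc r / L = (e / L) * (r / e) := by field_simp
        _ ≤ N * (r / e) ^ ρ := by gcongr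
    have h3 : 1 ≤ N * (r / e) ^ ρ := by
      rw [Real.div_rpow (by linarith) he0.le]
      have : 1 ≤ r ^ ρ := Real.one_le_rpow hr hρ.le
      have h5 : 0 < e ^ ρ := by positivity
      rw [← mul_div_assoc, le_div_iff₀ h5]
      nlinarith
    linarith
  · have h1 : (1 : ℝ) ≤ (r / e) ^ ρ := Real.one_le_rpow ((one_le_div he0).2 hre) hρ.le
    have h2 : ((A.filter fun a => p a ∈ Ico x (x + r)).card : ℝ) ≤ e / L + 2 := by
      refine le_trans ?_ (card_filter_cells_le hL A p hp 0 e he0.le)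
      refine Nat.cast_le.2 (Finset.card_le_card fun a ha => ?_)
      have haA := (Finset.mem_filter.1 ha).1
      refine Finset.mem_filter.2 ⟨haA, ?_, ?_⟩
      · exact (Real.exp_pos _).le.trans (hs a haA).1
      · rw [zero_add]; exact (hs a haA).2
    have h3 : 1 ≤ N := le_trans (Real.one_le_rpow (Real.one_le_exp (by positivity)) hρ.le) hN2
    nlinarith

/-- A set containing many integers has full dimension. -/
lemma one_le_macroDim_of_count {E : Set ℝ} (φ : ℕ → ℕ) (hφ : Function.Injective φ)
    (A : ℕ → Finset ℕ)
    (hs : ∀ k, ∀ s ∈ A k, Real.exp (φ k) ≤ s ∧ (s : ℝ) < Real.exp (φ k + 1 : ℕ))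
    (hE : ∀ᶠ k in atTop, ∀ s ∈ A k, (s : ℝ) ∈ E)
    (hsum : ∑' k, ENNReal.ofReal ((A k).card / Real.exp (φ k + 1 : ℕ)) = ∞) :
    1 ≤ macroDim E := by
  rw [← ENNReal.ofReal_one]
  refine le_macroDim_of_tsum fun ρ hρ hρ1 => ?_
  rw [eq_top_iff]
  refine le_trans ?_
    (ENNReal.tsum_comp_le_tsum_of_injective hφ fun n => shellContent (n + 1) ρ E)
  obtain ⟨N, hN⟩ := eventually_atTop.1 hE
  replace hsum := tsum_nat_add_eq_top N (fun n => ENNReal.ofReal_ne_top) hsum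
  have h3 : ∑' k, ENNReal.ofReal (1 / 3) *
      ENNReal.ofReal ((A (k + N)).card / Real.exp (φ (k + N) + 1 : ℕ)) = ∞ := by
    rw [ENNReal.tsum_mul_left, hsum, ENNReal.mul_top (by simp)]
  rw [← h3]
  refine le_trans (ENNReal.tsum_le_tsum fun k => ?_)
    (tsum_add_le_tsum N fun k => shellContent (φ k + 1) ρ E)
  have h1 : 1 ≤ Real.exp (φ (k + N) + 1 : ℕ) := Real.one_le_exp (by positivity)
  refine le_trans ?_ (le_shellContent_of_cells (L := 1) (N := Real.exp (φ (k + N) + 1 : ℕ)) hρ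
    hρ1.le one_pos (by simp) ?_ (A (k + N)) (fun a => (a : ℝ)) (fun a _ => by simp)
    (hN _ (by omega)) (hs _))
  · rw [← ENNReal.ofReal_mul (by positivity)]
    refine ENNReal.ofReal_le_ofReal (le_of_eq ?_)
    field_simp
  · conv_rhs => rw [← Real.rpow_one (Real.exp _)]
    exact Real.rpow_le_rpow_of_exponent_le h1 hρ1.le

variable {Ω : Type*} {mΩ : MeasurableSpace Ω} {P : Measure Ω} {B : ℝ≥0 → Ω → ℝ}

/-! ### Gaussian tails and the maximal inequality -/

/-- A Brownian motion all of whose paths are continuous and all of whose marginals are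
measurable. -/
structure IsRegularBrownian (B : ℝ≥0 → Ω → ℝ) (P : Measure Ω) : Prop where
  pre : IsPreBrownianReal B P
  meas : ∀ t, Measurable (B t)
  cont : ∀ ω, Continuous (B · ω)

/-- Off a measurable set of full measure the path is set to zero. On that set it is continuous and
agrees with measurable versions at a dense sequence of times, so every marginal is a pointwise limit
of measurable functions. -/
lemma exists_isRegularBrownian {P : Measure Ω} {B : ℝ≥0 → Ω → ℝ} (hB : IsBrownianReal B P) :
    ∃ B' : ℝ≥0 → Ω → ℝ, IsRegularBrownian B' P ∧ ∀ᵐ ω ∂P, ∀ t, B t ω = B' t ω := by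
  let d := TopologicalSpace.denseSeq ℝ≥0
  let M : ℝ≥0 → Ω → ℝ := fun t => (hB.aemeasurable t).mk
  have hae : ∀ᵐ ω ∂P, Continuous (B · ω) ∧ ∀ n, B (d n) ω = M (d n) ω := by
    filter_upwards [hB.cont, ae_all_iff.2 fun n => (hB.aemeasurable (d n)).ae_eq_mk] with ω h1 h2
    exact ⟨h1, h2⟩
  obtain ⟨A, hA, hAm, hAB⟩ := hae.exists_measurable_mem
  have heq : ∀ᵐ ω ∂P, ∀ t, B t ω = A.indicator (B t) ω := by
    filter_upwards [hA] with ω hω t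
    rw [indicator_of_mem hω]
  refine ⟨fun t => A.indicator (B t), ⟨hB.congr fun t => heq.mono fun ω h => h t, ?_, ?_⟩, heq⟩
  · intro t
    obtain ⟨u, hu, hut⟩ := mem_closure_iff_seq_limit.1
      ((TopologicalSpace.denseRange_denseSeq ℝ≥0) t)
    choose n hn using hu
    refine measurable_of_tendsto_metrizable (f := fun k => A.indicator (M (u k)))
      (fun k => (hB.aemeasurable (u k)).measurable_mk.indicator hAm) ?_
    rw [tendsto_pi_nhds]
    intro ω
    by_cases hω : ω ∈ A
    · simp only [indicator_of_mem hω]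
      refine (((hAB ω hω).1.tendsto t).comp hut).congr fun k => ?_
      simp only [Function.comp, ← hn k]
      exact (hAB ω hω).2 _
    · simp only [indicator_of_notMem hω]
      exact tendsto_const_nhds
  · intro ω
    by_cases hω : ω ∈ A
    · simp only [indicator_of_mem hω]; exact (hAB ω hω).1
    · simp only [indicator_of_notMem hω]; exact continuous_const

lemma half_le_gaussianReal_Ici (v : ℝ≥0) : 1 / 2 ≤ gaussianReal 0 v (Ici 0) := by
  have h1 : gaussianReal 0 v (Iic 0) = gaussianReal 0 v (Ici 0) := by
    conv_lhs => rw [← neg_zero (G := ℝ), ← gaussianReal_map_neg]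
    rw [Measure.map_apply (by fun_prop) measurableSet_Iic]
    congr 1
    ext x
    simp
  have h2 : 1 ≤ gaussianReal 0 v (Iic 0) + gaussianReal 0 v (Ici 0) := by
    rw [← measure_univ (μ := gaussianReal 0 v), ← Iic_union_Ici (a := (0 : ℝ))]
    exact measure_union_le _ _
  rw [h1, ← two_mul] at h2
  exact ENNReal.div_le_of_le_mul' h2

lemma gaussianReal_Ici_le {v : ℝ≥0} {a : ℝ} (ha : 0 ≤ a) :
    gaussianReal 0 v (Ici a) ≤ ENNReal.ofReal (Real.exp (-a ^ 2 / (2 * v))) := by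
  have h : HasSubgaussianMGF id v (gaussianReal 0 v) := by
    refine ⟨fun t => integrable_exp_mul_gaussianReal t, fun t => ?_⟩
    rw [mgf_id_gaussianReal]
    simp
  have := h.measure_ge_le ha
  rw [← ENNReal.ofReal_toReal (measure_ne_top (gaussianReal 0 v) (Ici a))]
  exact ENNReal.ofReal_le_ofReal this

/-- It suffices to integrate the density over `[y, y + v/y]`: the length is at least `1 / (2y)`, and
the exponent drops by at most `1 + v / (2y²) ≤ 3/2` below its value at `y`. -/
lemma exists_le_gaussianReal_Ici : ∃ c : ℝ, 0 < c ∧ ∀ v : ℝ≥0, 1 / 2 ≤ v → v ≤ 1 →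
    ∀ y : ℝ, 1 ≤ y →
      ENNReal.ofReal (c / y * Real.exp (-y ^ 2 / (2 * v))) ≤ gaussianReal 0 v (Ici y) := by
  refine ⟨1 / 2 * (√(2 * Real.pi))⁻¹ * Real.exp (-(3 / 2)), by positivity, fun v hv hv1 y hy => ?_⟩
  have hv0 : 0 < v := lt_of_lt_of_le (by norm_num) hv
  have hvr : (1 / 2 : ℝ) ≤ v := by exact_mod_cast hv
  have hvr1 : (v : ℝ) ≤ 1 := by exact_mod_cast hv1
  have hvr0 : (0 : ℝ) < v := by exact_mod_cast hv0
  have hy0 : 0 < y := by linarith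
  rw [gaussianReal_apply _ hv0.ne']
  set k := (√(2 * Real.pi))⁻¹ * Real.exp (-(3 / 2)) * Real.exp (-y ^ 2 / (2 * v)) with hk
  have hk0 : 0 ≤ k := by positivity
  calc _ ≤ ENNReal.ofReal k * volume (Icc y (y + v / y)) := by
        rw [Real.volume_Icc, ← ENNReal.ofReal_mul hk0]
        refine ENNReal.ofReal_le_ofReal ?_
        have : (1 / 2 : ℝ) / y ≤ v / y := by gcongr
        calc _ = k * ((1 / 2) / y) := by rw [hk]; ring
          _ ≤ k * (v / y) := by gcongr
          _ = _ := by ring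
    _ = ∫⁻ x in Icc y (y + v / y), ENNReal.ofReal k := by simp
    _ ≤ ∫⁻ x in Icc y (y + v / y), gaussianPDF 0 v x := by
        refine setLIntegral_mono' measurableSet_Icc fun x hx => ?_
        rw [gaussianPDF]
        refine ENNReal.ofReal_le_ofReal ?_
        rw [gaussianPDFReal, hk, mul_assoc, ← Real.exp_add, sub_zero]
        have h1 : (√(2 * Real.pi))⁻¹ ≤ (√(2 * Real.pi * v))⁻¹ := by
          refine inv_anti₀ (by positivity) (Real.sqrt_le_sqrt ?_)
          nlinarith [Real.pi_pos]
        refine mul_le_mul h1 (Real.exp_le_exp.2 ?_) (by positivity) (by positivity)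
        have h2 : x ^ 2 ≤ (y + v / y) ^ 2 := by
          exact pow_le_pow_left₀ (hy0.le.trans hx.1) hx.2 2
        have h3 : (y + v / y) ^ 2 / (2 * v) = y ^ 2 / (2 * v) + 1 + v / (2 * y ^ 2) := by
          field_simp; ring
        have h4 : (v : ℝ) / (2 * y ^ 2) ≤ 1 / 2 := by
          rw [div_le_iff₀ (by positivity)]; nlinarith
        have h5 : x ^ 2 / (2 * v) ≤ (y + v / y) ^ 2 / (2 * v) := by gcongr
        rw [neg_div, neg_div]
        linarith
    _ ≤ _ := lintegral_mono_set Icc_subset_Ici_self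

lemma IsRegularBrownian.neg (hB : IsRegularBrownian B P) : IsRegularBrownian (-B) P where
  pre := hB.pre.neg
  meas t := (hB.meas t).neg
  cont ω := (hB.cont ω).neg

lemma IsRegularBrownian.measure_sub_ge (hB : IsRegularBrownian B P) (s t : ℝ≥0) (a : ℝ) :
    P {ω | a ≤ B t ω - B s ω} = gaussianReal 0 (nndist t.1 s.1) (Ici a) := by
  rw [← (hB.pre.hasLaw_sub t s).map_eq, Measure.map_apply_of_aemeasurable
    (hB.pre.hasLaw_sub t s).aemeasurable measurableSet_Ici]
  rfl

/-- Lévy's maximal inequality for finitely many times. -/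
lemma IsRegularBrownian.measure_exists_le_finite (hB : IsRegularBrownian B P) (N : ℕ)
    (t : ℕ → ℝ≥0) (ht : Monotone t) {T : ℝ≥0} (hT : ∀ k ≤ N, t k ≤ T) (a : ℝ) :
    P {ω | ∃ k ≤ N, a < B (t k) ω} ≤ 2 * P {ω | a < B T ω} := by
  -- Decomposition by first passage: on `A k` the level is first exceeded at `t k`. Independently,
  -- `D k` has probability at least `1/2`, and `D k ∩ A k` forces the final value above `a`.
  -- Disjointness of the `A k` then yields the factor `2`.
  let A : ℕ → Set Ω := fun k => {ω | a < B (t k) ω ∧ ∀ j < k, B (t j) ω ≤ a}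
  let D : ℕ → Set Ω := fun k => {ω | 0 ≤ B T ω - B (t k) ω}
  have hAm : ∀ k, MeasurableSet (A k) := fun k => by
    have : A k = {ω | a < B (t k) ω} ∩ ⋂ j, ⋂ (_ : j < k), {ω | B (t j) ω ≤ a} := by
      ext ω; simp [A]
    rw [this]
    exact (measurableSet_lt measurable_const (hB.meas _)).inter <|
      .iInter fun j => .iInter fun _ => measurableSet_le (hB.meas _) measurable_const
  have hDm : ∀ k, MeasurableSet (D k) := fun k =>
    measurableSet_le measurable_const ((hB.meas _).sub (hB.meas _))
  have hind : ∀ k ≤ N, P (D k ∩ A k) = P (D k) * P (A k) := fun k hk => by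
    let S : Set (Iic (t k) → ℝ) := {f | a < f ⟨t k, self_mem_Iic⟩} ∩
      ⋂ (j : ℕ) (hj : j < k), {f | f ⟨t j, ht hj.le⟩ ≤ a}
    have hS : MeasurableSet S :=
      (measurableSet_lt measurable_const (measurable_pi_apply _)).inter <|
        .iInter fun j => .iInter fun _ => measurableSet_le (measurable_pi_apply _) measurable_const
    have h := (hB.pre.indepFun_shift (t k)).measure_inter_preimage_eq_mul
      {f | 0 ≤ f (T - t k)} S (measurableSet_le measurable_const (measurable_pi_apply _)) hS
    have h1 : (fun ω t' => B (t k + t') ω - B (t k) ω) ⁻¹' {f | 0 ≤ f (T - t k)} = D k := by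
      ext ω; simp [D, add_tsub_cancel_of_le (hT k hk)]
    have h2 : (fun ω (t' : Iic (t k)) => B t' ω) ⁻¹' S = A k := by
      ext ω; simp [S, A]
    rwa [h1, h2] at h
  have hD : ∀ k, 1 / 2 ≤ P (D k) := fun k => by
    rw [hB.measure_sub_ge]; exact half_le_gaussianReal_Ici _
  have hdis : Pairwise (Function.onFun Disjoint A) := by
    refine (pairwise_disjoint_on A).2 fun i j hij => ?_
    rw [Set.disjoint_left]
    rintro ω h1 h2
    exact absurd (h2.2 i hij) (not_le.2 h1.1)
  calc P {ω | ∃ k ≤ N, a < B (t k) ω} ≤ P (⋃ k ∈ Finset.range (N + 1), A k) := by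
        refine measure_mono fun ω hω => ?_
        classical
        have hex : ∃ k, k ≤ N ∧ a < B (t k) ω := hω
        obtain ⟨h1, h2⟩ := Nat.find_spec hex
        refine mem_iUnion₂.2 ⟨Nat.find hex, Finset.mem_range.2 (by omega), h2, fun j hj => ?_⟩
        have := Nat.find_min hex hj
        push Not at this
        exact this (by omega)
    _ ≤ ∑ k ∈ Finset.range (N + 1), P (A k) := measure_biUnion_finset_le _ _
    _ ≤ ∑ k ∈ Finset.range (N + 1), 2 * P (D k ∩ A k) := by
        refine Finset.sum_le_sum fun k hk => ?_
        rw [hind k (by simpa [Nat.lt_succ_iff] using hk), ← mul_assoc]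
        refine le_mul_of_one_le_left' ?_
        calc (1 : ℝ≥0∞) = 2 * (1 / 2) := by rw [one_div, ENNReal.mul_inv_cancel] <;> simp
          _ ≤ 2 * P (D k) := by gcongr; exact hD k
    _ = 2 * P (⋃ k ∈ Finset.range (N + 1), D k ∩ A k) := by
        rw [← Finset.mul_sum, measure_biUnion_finset]
        · exact fun i _ j _ hij => (hdis hij).mono inter_subset_right inter_subset_right
        · exact fun k _ => (hDm k).inter (hAm k)
    _ ≤ 2 * P {ω | a < B T ω} := by
        gcongr
        refine iUnion₂_subset fun k _ ω hω => ?_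
        have h1 : 0 ≤ B T ω - B (t k) ω := hω.1
        have h2 : a < B (t k) ω := hω.2.1
        change a < B T ω
        linarith

/-- A strict exceedance is an open condition, so by continuity it is visible on some dyadic grid of
`[0, T]`. The grids are nested, hence the finite bound passes to the increasing union. -/
lemma IsRegularBrownian.measure_exists_gt (hB : IsRegularBrownian B P) (T : ℝ≥0) (a : ℝ) :
    P {ω | ∃ t ≤ T, a < B t ω} ≤ 2 * P {ω | a < B T ω} := by
  let τ : ℕ → ℕ → ℝ≥0 := fun N k => T * (k / 2 ^ N)
  have hmono : ∀ N, Monotone (τ N) := fun N i j hij => by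
    simp only [τ]; gcongr
  have hsub : {ω | ∃ t ≤ T, a < B t ω} ⊆ ⋃ N, {ω | ∃ k ≤ 2 ^ N, a < B (τ N k) ω} := by
    rintro ω ⟨t, htT, hat⟩
    have hlim : Tendsto (fun N : ℕ => τ N ⌊(t / T) * 2 ^ N⌋₊) atTop (nhds t) := by
      have h1 : Tendsto (fun N : ℕ => (⌊((t / T : ℝ≥0) : ℝ) * 2 ^ N⌋₊ : ℝ) / 2 ^ N) atTop
          (nhds ((t / T : ℝ≥0) : ℝ)) :=
        (tendsto_nat_floor_mul_div_atTop (NNReal.coe_nonneg _)).comp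
          (tendsto_pow_atTop_atTop_of_one_lt one_lt_two)
      have h2 : (T : ℝ) * ((t / T : ℝ≥0) : ℝ) = t := by
        rcases eq_or_ne T 0 with rfl | hT
        · have : t = 0 := le_antisymm htT bot_le
          simp [this]
        · push_cast
          field_simp
      have h3 := h1.const_mul (T : ℝ)
      rw [h2] at h3
      rw [← NNReal.tendsto_coe]
      refine h3.congr fun N => ?_
      simp only [τ]
      push_cast
      congr 3
    have hev : ∀ᶠ x in nhds t, a < B x ω := (hB.cont ω).continuousAt.eventually_const_lt hat
    obtain ⟨N, hN⟩ := (hlim.eventually hev).exists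
    refine mem_iUnion.2 ⟨N, _, ?_, hN⟩
    refine Nat.floor_le_of_le ?_
    push_cast
    refine mul_le_of_le_one_left (by positivity) (div_le_one_of_le₀ htT bot_le)
  have hdir : Monotone fun N => {ω | ∃ k ≤ 2 ^ N, a < B (τ N k) ω} := by
    refine monotone_nat_of_le_succ fun N => ?_
    rintro ω ⟨k, hk, hak⟩
    refine ⟨2 * k, by rw [pow_succ]; omega, ?_⟩
    have : τ (N + 1) (2 * k) = τ N k := by
      simp only [τ]; push_cast; rw [pow_succ]; field_simp
    rw [this]; exact hak
  refine (measure_mono hsub).trans ?_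
  rw [hdir.measure_iUnion]
  refine iSup_le fun N => hB.measure_exists_le_finite (2 ^ N) (τ N) (hmono N) (fun k hk => ?_) a
  refine mul_le_of_le_one_right bot_le (div_le_one_of_le₀ (by exact_mod_cast hk) bot_le)

lemma IsRegularBrownian.measure_exists_abs_ge (hB : IsRegularBrownian B P) {T : ℝ≥0}
    {a : ℝ} (ha : 0 < a) :
    P {ω | ∃ t ≤ T, a ≤ |B t ω|} ≤ ENNReal.ofReal (4 * Real.exp (-a ^ 2 / (2 * T))) := by
  have key : ∀ C : ℝ≥0 → Ω → ℝ, IsRegularBrownian C P → ∀ b, 0 ≤ b →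
      P {ω | ∃ t ≤ T, b < C t ω} ≤ ENNReal.ofReal (2 * Real.exp (-b ^ 2 / (2 * T))) := by
    intro C hC b hb
    refine (hC.measure_exists_gt T b).trans ?_
    rw [ENNReal.ofReal_mul zero_le_two, ENNReal.ofReal_ofNat]
    gcongr
    refine le_trans ?_ (gaussianReal_Ici_le hb)
    rw [← (hC.pre.hasLaw_eval T).map_eq, Measure.map_apply (hC.meas T) measurableSet_Ici]
    exact measure_mono fun ω (hω : b < C T ω) => mem_preimage.2 (mem_Ici.2 hω.le)
  -- The maximal inequality concerns strict exceedance, so it is applied at levels `b < a` and `b`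
  -- tends to `a` at the end. The factor `4` is `2` for each sign.
  have hb : ∀ b, 0 ≤ b → b < a →
      P {ω | ∃ t ≤ T, a ≤ |B t ω|} ≤ ENNReal.ofReal (4 * Real.exp (-b ^ 2 / (2 * T))) := by
    intro b hb0 hba
    have : {ω | ∃ t ≤ T, a ≤ |B t ω|} ⊆ {ω | ∃ t ≤ T, b < B t ω} ∪ {ω | ∃ t ≤ T, b < (-B) t ω} := by
      rintro ω ⟨t, ht, h⟩
      rcases le_abs.1 h with h | h
      · exact .inl ⟨t, ht, hba.trans_le h⟩
      · exact .inr ⟨t, ht, hba.trans_le h⟩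
    refine (measure_mono this).trans <| (measure_union_le _ _).trans <|
      (add_le_add (key B hB b hb0) (key (-B) hB.neg b hb0)).trans ?_
    rw [← ENNReal.ofReal_add (by positivity) (by positivity)]
    refine ENNReal.ofReal_le_ofReal (le_of_eq (by ring))
  have hlim : Tendsto (fun b : ℝ => ENNReal.ofReal (4 * Real.exp (-b ^ 2 / (2 * T))))
      (nhdsWithin a (Iio a)) (nhds (ENNReal.ofReal (4 * Real.exp (-a ^ 2 / (2 * T))))) := by
    refine (Continuous.tendsto ?_ a).mono_left nhdsWithin_le_nhds
    exact ENNReal.continuous_ofReal.comp (by fun_prop)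
  refine ge_of_tendsto hlim ?_
  filter_upwards [Ioo_mem_nhdsLT ha] with b hbm
  exact hb b hbm.1.le hbm.2

/-! ### Upper bounds for the Ornstein-Uhlenbeck process -/

/-- The event that the Ornstein-Uhlenbeck process is tall somewhere on `[k, k + 1]`. -/
def tallEvent (B : ℝ≥0 → Ω → ℝ) (γ : ℝ) (k : ℕ) : Set Ω :=
  {ω | ∃ s : ℝ, k ≤ s ∧ s ≤ k + 1 ∧ γ * √(2 * Real.log k) ≤ |(ouProcess B s ω)|}

lemma mem_tallEvent {γ s : ℝ} (hγ : 0 ≤ γ) (hs : 0 ≤ s) {ω : Ω}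
    (h : γ * √(2 * Real.log s) ≤ |(ouProcess B s ω)|) : ω ∈ tallEvent B γ ⌊s⌋₊ := by
  refine ⟨s, Nat.floor_le hs, (Nat.lt_floor_add_one s).le, le_trans ?_ h⟩
  -- For `⌊s⌋₊ = 0` the threshold vanishes, because `Real.log 0 = 0`.
  rcases Nat.eq_zero_or_pos ⌊s⌋₊ with h0 | h0
  · rw [h0]; simp; positivity
  · have : (0 : ℝ) < ⌊s⌋₊ := by exact_mod_cast h0
    gcongr
    exact Nat.floor_le hs

lemma IsRegularBrownian.exists_measure_tallEvent_le (hB : IsRegularBrownian B P) {γ β : ℝ}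
    (hγ : 0 < γ) (hβ : 0 < β) (hβγ : β < γ ^ 2) :
    ∃ C : ℝ, 0 ≤ C ∧ ∀ k : ℕ,
      P (tallEvent B γ k) ≤ ENNReal.ofReal (C * ((k : ℝ) + 1) ^ (-β)) := by
  have hP : IsProbabilityMeasure P := hB.pre.isGaussianProcess.isProbabilityMeasure
  -- On a piece of length `1 / N` the level scales with the left end and the variance with the right
  -- end. This costs a factor `e^{-1/N}` in the exponent, which is absorbed by `β < γ²`.
  obtain ⟨N, hN0, hN⟩ : ∃ N : ℕ, 0 < N ∧ β ≤ γ ^ 2 * Real.exp (-(1 / N)) := by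
    have h1 : Tendsto (fun N : ℕ => γ ^ 2 * Real.exp (-(1 / N))) atTop (nhds (γ ^ 2)) := by
      have := (Real.continuous_exp.tendsto _).comp
        (tendsto_one_div_atTop_nhds_zero_nat (𝕜 := ℝ)).neg
      simpa [Function.comp_def] using this.const_mul (γ ^ 2)
    obtain ⟨N, h2, h3⟩ := ((eventually_gt_atTop 0).and (h1.eventually_const_lt hβγ)).exists
    exact ⟨N, h2, h3.le⟩
  refine ⟨2 ^ β * (4 * (N + 1)), by positivity, fun k => ?_⟩
  -- For `k < 2` the level is zero, but the factor `2^β` makes the claimed bound at least `1`. For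
  -- `k ≥ 2` the same factor pays for replacing `k` by `k + 1 ≤ 2k`.
  rcases Nat.lt_or_ge k 2 with hk | hk
  · refine prob_le_one.trans ?_
    rw [ENNReal.one_le_ofReal, Real.rpow_neg (by positivity), ← div_eq_mul_inv,
      le_div_iff₀ (by positivity), one_mul]
    have h1 : ((k : ℝ) + 1) ^ β ≤ 2 ^ β := by
      have : (k : ℝ) ≤ 1 := by exact_mod_cast Nat.lt_succ_iff.1 hk
      gcongr; linarith
    have h2 : (0 : ℝ) < 2 ^ β := by positivity
    have h3 : (0 : ℝ) ≤ N := by positivity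
    nlinarith
  have hk2 : (2 : ℝ) ≤ k := by exact_mod_cast hk
  have hlog : 0 < Real.log k := Real.log_pos (by linarith)
  have hNr : (0 : ℝ) < N := by exact_mod_cast hN0
  let T : ℕ → ℝ≥0 := fun j => (Real.exp (k + (j + 1) / N)).toNNReal
  let a : ℕ → ℝ := fun j => γ * √(2 * Real.log k) * Real.exp ((k + j / N) / 2)
  -- There are `N + 1` pieces because the endpoint `s = k + 1` has index `N`.
  have hsub : tallEvent B γ k ⊆
      ⋃ j ∈ Finset.range (N + 1), {ω | ∃ t ≤ T j, a j ≤ |B t ω|} := by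
    rintro ω ⟨s, h1, h2, h3⟩
    have hs : 0 ≤ (s - k) * N := mul_nonneg (by linarith) hNr.le
    have hfl := Nat.floor_le hs
    have hfl2 := Nat.lt_floor_add_one ((s - k) * N)
    refine mem_iUnion₂.2 ⟨⌊(s - k) * N⌋₊, ?_, (Real.exp s).toNNReal, ?_, ?_⟩
    · rw [Finset.mem_range, Nat.lt_succ_iff]
      refine Nat.floor_le_of_le ?_
      nlinarith
    · refine Real.toNNReal_le_toNNReal (Real.exp_le_exp.2 ?_)
      have : s - k ≤ ((⌊(s - k) * N⌋₊ : ℝ) + 1) / N := by rw [le_div_iff₀ hNr]; exact hfl2.le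
      linarith
    · have h4 : (⌊(s - k) * N⌋₊ : ℝ) / N ≤ s - k := by rw [div_le_iff₀ hNr]; exact hfl
      rw [ouProcess, abs_mul, abs_of_pos (Real.exp_pos _)] at h3
      have h5 : |B (Real.exp s).toNNReal ω|
          = Real.exp (s / 2) * (Real.exp (-s / 2) * |B (Real.exp s).toNNReal ω|) := by
        rw [← mul_assoc, ← Real.exp_add]; ring_nf; simp
      rw [h5]
      simp only [a]
      rw [mul_comm]
      refine mul_le_mul (Real.exp_le_exp.2 (by linarith)) h3 (by positivity) (by positivity)
  refine (measure_mono hsub).trans ((measure_biUnion_finset_le _ _).trans ?_)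
  have hj : ∀ j ∈ Finset.range (N + 1), P {ω | ∃ t ≤ T j, a j ≤ |B t ω|} ≤
      ENNReal.ofReal (4 * 2 ^ β * ((k : ℝ) + 1) ^ (-β)) := by
    intro j _
    refine (hB.measure_exists_abs_ge (by positivity)).trans (ENNReal.ofReal_le_ofReal ?_)
    rw [mul_assoc]
    refine mul_le_mul_of_nonneg_left ?_ (by norm_num)
    have h1 : -(a j) ^ 2 / (2 * T j) = -(γ ^ 2 * Real.exp (-(1 / N)) * Real.log k) := by
      simp only [a, T, Real.coe_toNNReal _ (Real.exp_pos _).le]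
      rw [mul_pow, mul_pow, Real.sq_sqrt (by positivity), ← Real.exp_nat_mul]
      have : Real.exp ((k : ℝ) + (j + 1) / N) =
          Real.exp ((2 : ℕ) * ((k + j / N) / 2)) * Real.exp (1 / N) := by
        rw [← Real.exp_add]; push_cast; ring_nf
      rw [this, Real.exp_neg]
      field_simp
    rw [h1]
    have h2 : Real.log (k + 1) ≤ Real.log 2 + Real.log k := by
      rw [← Real.log_mul (by norm_num) (by positivity)]
      exact Real.log_le_log (by positivity) (by linarith)
    rw [Real.rpow_def_of_pos (by norm_num), Real.rpow_def_of_pos (by positivity), ← Real.exp_add]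
    refine Real.exp_le_exp.2 ?_
    have h3 : β * Real.log k ≤ γ ^ 2 * Real.exp (-(1 / N)) * Real.log k := by gcongr
    have h4 : β * Real.log (k + 1) ≤ β * (Real.log 2 + Real.log k) := by gcongr
    linarith
  refine (Finset.sum_le_sum hj).trans ?_
  rw [Finset.sum_const, Finset.card_range, nsmul_eq_mul, ← ENNReal.ofReal_natCast,
    ← ENNReal.ofReal_mul (by positivity)]
  refine ENNReal.ofReal_le_ofReal (le_of_eq ?_)
  push_cast; ring

/-- The upper half of the law of the iterated logarithm. -/
lemma IsRegularBrownian.eventually_abs_ouProcess_lt (hB : IsRegularBrownian B P) {γ : ℝ}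
    (hγ : 1 < γ) :
    ∀ᵐ ω ∂P, ∀ᶠ s : ℝ in atTop, |(ouProcess B s ω)| < γ * √(2 * Real.log s) := by
  have h1 : 1 < γ ^ 2 := by nlinarith
  obtain ⟨C, hC, h⟩ := hB.exists_measure_tallEvent_le (γ := γ) (β := (1 + γ ^ 2) / 2) (by linarith)
    (by linarith) (by linarith)
  have hsum : ∑' k, P (tallEvent B γ k) ≠ ∞ := by
    refine ne_top_of_le_ne_top ?_ (ENNReal.tsum_le_tsum h)
    have hs : Summable fun k : ℕ => C * ((k : ℝ) + 1) ^ (-((1 + γ ^ 2) / 2)) := by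
      refine Summable.mul_left C ?_
      have := (summable_nat_add_iff 1).2
        (Real.summable_nat_rpow (p := -((1 + γ ^ 2) / 2)).2 (by linarith))
      simpa using this
    exact hs.tsum_ofReal_ne_top
  filter_upwards [ae_eventually_notMem hsum] with ω hω
  filter_upwards [tendsto_nat_floor_atTop.eventually hω, eventually_ge_atTop 0] with s h2 h3
  by_contra! hcon
  exact h2 (mem_tallEvent (by linarith) h3 hcon)

lemma IsRegularBrownian.macroDim_le_of_lt (hB : IsRegularBrownian B P) {γ ρ : ℝ}
    (hγ : 0 < γ) (hρ : 0 < ρ) (hργ : 1 - γ ^ 2 < ρ) :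
    ∀ᵐ ω ∂P, ∀ E : Set ℝ, (∀ s ∈ E, 0 ≤ s) →
      (∀ᶠ s in atTop, s ∈ E → γ * √(2 * Real.log s) ≤ |(ouProcess B s ω)|) →
      macroDim E ≤ ENNReal.ofReal ρ := by
  -- The midpoint of `max 0 (1 - ρ)` and `γ²`: positive, admissible for the tail bound, and with `1
  -- - β - ρ < 0`.
  set β := (γ ^ 2 + max 0 (1 - ρ)) / 2 with hβdef
  have hγ2 : 0 < γ ^ 2 := by positivity
  have hβ : 0 < β := by have := le_max_left 0 (1 - ρ); linarith
  have hβγ : β < γ ^ 2 := by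
    have : max 0 (1 - ρ) < γ ^ 2 := max_lt hγ2 (by linarith)
    linarith
  have hβρ : 1 - β - ρ < 0 := by have := le_max_right 0 (1 - ρ); linarith
  obtain ⟨C, hC, h⟩ := hB.exists_measure_tallEvent_le hγ hβ hβγ
  let I : ℕ → Finset ℕ := fun n => Finset.Ico ⌊Real.exp n⌋₊ ⌈Real.exp (n + 1 : ℕ)⌉₊
  -- A random majorant of the content. The tall events are uncountable unions over times, so
  -- measurable hulls of the same measure are used to take expectations.
  let a : ℕ → Ω → ℝ≥0∞ := fun n ω =>
    (∑ k ∈ I n, (toMeasurable P (tallEvent B γ k)).indicator 1 ω) *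
      ENNReal.ofReal (Real.exp (-((n + 1 : ℕ) * ρ)))
  have hmeas : ∀ k, Measurable ((toMeasurable P (tallEvent B γ k)).indicator (1 : Ω → ℝ≥0∞)) :=
    fun k => measurable_one.indicator (measurableSet_toMeasurable _ _)
  have hmeasa : ∀ n, Measurable (a n) := fun n =>
    (Finset.measurable_fun_sum _ fun k _ => hmeas k).mul_const _
  have hint : ∀ n, ∫⁻ ω, a n ω ∂P ≤
      ENNReal.ofReal (2 * Real.exp 1 * C * Real.exp (-ρ) * Real.exp ((1 - β - ρ) * n)) := by
    intro n
    have hE1 : 1 ≤ Real.exp (n + 1 : ℕ) := Real.one_le_exp (by positivity)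
    simp only [a]
    rw [lintegral_mul_const _ (Finset.measurable_fun_sum _ fun k _ => hmeas k),
      lintegral_finsetSum _ fun k _ => hmeas k]
    have h1 : ∀ k ∈ I n, ∫⁻ ω, (toMeasurable P (tallEvent B γ k)).indicator 1 ω ∂P ≤
        ENNReal.ofReal (C * Real.exp (-β * n)) := by
      intro k hk
      rw [lintegral_indicator_one (measurableSet_toMeasurable _ _), measure_toMeasurable]
      refine (h k).trans (ENNReal.ofReal_le_ofReal (mul_le_mul_of_nonneg_left ?_ hC))
      have h2 : Real.exp n ≤ (k : ℝ) + 1 := by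
        have h3 := Nat.lt_floor_add_one (Real.exp n)
        have h4 : (⌊Real.exp n⌋₊ : ℝ) ≤ k := by exact_mod_cast (Finset.mem_Ico.1 hk).1
        linarith
      calc ((k : ℝ) + 1) ^ (-β) ≤ (Real.exp n) ^ (-β) :=
            Real.rpow_le_rpow_of_nonpos (Real.exp_pos _) h2 (by linarith)
        _ = Real.exp (-β * n) := by rw [← Real.exp_mul, mul_comm]
    refine (mul_le_mul_left (Finset.sum_le_sum h1) _).trans ?_
    rw [Finset.sum_const, nsmul_eq_mul, ← ENNReal.ofReal_natCast,
      ← ENNReal.ofReal_mul (by positivity), ← ENNReal.ofReal_mul (by positivity)]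
    refine ENNReal.ofReal_le_ofReal ?_
    have h5 : ((I n).card : ℝ) ≤ 2 * Real.exp (n + 1 : ℕ) := by
      rw [Nat.card_Ico]
      have := Nat.ceil_lt_add_one (Real.exp_pos (n + 1 : ℕ)).le
      have h6 : ((⌈Real.exp (n + 1 : ℕ)⌉₊ - ⌊Real.exp n⌋₊ : ℕ) : ℝ) ≤ ⌈Real.exp (n + 1 : ℕ)⌉₊ := by
        exact_mod_cast Nat.sub_le _ _
      linarith
    calc _ ≤ 2 * Real.exp (n + 1 : ℕ) * (C * Real.exp (-β * n)) *
          Real.exp (-((n + 1 : ℕ) * ρ)) := by gcongr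
      _ = 2 * C * (Real.exp (n + 1 : ℕ) * Real.exp (-β * n) * Real.exp (-((n + 1 : ℕ) * ρ))) := by
          ring
      _ = 2 * C * (Real.exp 1 * Real.exp (-ρ) * Real.exp ((1 - β - ρ) * n)) := by
          rw [← Real.exp_add, ← Real.exp_add, ← Real.exp_add, ← Real.exp_add]
          push_cast; ring_nf
      _ = _ := by ring
  have hfin : ∫⁻ ω, ∑' n, a n ω ∂P ≠ ∞ := by
    rw [lintegral_tsum fun n => (hmeasa n).aemeasurable]
    exact ne_top_of_le_ne_top (tsum_ofReal_exp_mul_ne_top _ hβρ) (ENNReal.tsum_le_tsum hint)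
  filter_upwards [ae_lt_top (Measurable.tsum hmeasa) hfin] with ω hω E hE0 hE
  refine macroDim_le_of_tsum hρ (fun n => a n ω) hω.ne ?_
  obtain ⟨R, hR⟩ := eventually_atTop.1 hE
  have h1 : ∀ᶠ n : ℕ in atTop, R ≤ Real.exp n :=
    (Real.tendsto_exp_atTop.comp tendsto_natCast_atTop_atTop).eventually_ge_atTop R
  filter_upwards [h1] with n hn
  classical
  refine (shellContent_le_card ((I n).filter fun k => ω ∈ tallEvent B γ k)
    (fun k : ℕ => (k : ℝ)) ?_).trans ?_
  · rintro y ⟨hy, hys⟩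
    have hy0 := hE0 y hy
    have hy1 : Real.exp n ≤ y := by
      by_contra! hlt
      exact hys.2 ⟨by linarith [Real.exp_pos n], hlt⟩
    have hy2 := (shell_subset_window _ hys).2
    refine mem_iUnion₂.2 ⟨⌊y⌋₊, Finset.mem_filter.2 ⟨Finset.mem_Ico.2 ⟨?_, ?_⟩, ?_⟩,
      Nat.floor_le hy0, Nat.lt_floor_add_one y⟩
    · exact Nat.floor_le_floor hy1
    · exact Nat.lt_ceil.2 ((Nat.floor_le hy0).trans_lt hy2)
    · exact mem_tallEvent hγ.le hy0 (hR y (hn.trans hy1) hy)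
  · refine mul_le_mul_left ?_ _
    rw [Finset.card_filter]
    push_cast
    refine Finset.sum_le_sum fun k _ => ?_
    split_ifs with hk
    · rw [indicator_of_mem (subset_toMeasurable _ _ hk)]; simp
    · exact bot_le

lemma IsRegularBrownian.macroDim_le (hB : IsRegularBrownian B P) {γ : ℝ}
    (hγ : 0 < γ) (hγ1 : γ ≤ 1) :
    ∀ᵐ ω ∂P, ∀ E : Set ℝ, (∀ s ∈ E, 0 ≤ s) →
      (∀ᶠ s in atTop, s ∈ E → γ * √(2 * Real.log s) ≤ |(ouProcess B s ω)|) →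
      macroDim E ≤ ENNReal.ofReal (1 - γ ^ 2) := by
  have h0 : 0 ≤ 1 - γ ^ 2 := by nlinarith
  have hm : ∀ m : ℕ, (0 : ℝ) < 1 / ((m : ℝ) + 1) := fun m => by positivity
  have := ae_all_iff.2 fun m : ℕ => hB.macroDim_le_of_lt (ρ := 1 - γ ^ 2 + 1 / ((m : ℝ) + 1)) hγ
    (by linarith [hm m]) (by linarith [hm m])
  filter_upwards [this] with ω hω E hE0 hE
  have hlim : Tendsto (fun m : ℕ => ENNReal.ofReal (1 - γ ^ 2 + 1 / ((m : ℝ) + 1))) atTop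
      (nhds (ENNReal.ofReal (1 - γ ^ 2))) := by
    refine ENNReal.tendsto_ofReal ?_
    simpa using (tendsto_one_div_add_atTop_nhds_zero_nat (𝕜 := ℝ)).const_add (1 - γ ^ 2)
  exact ge_of_tendsto' hlim fun m => hω m E hE0 hE

/-! ### Increments of Brownian motion on the exponential scale -/

/-- The increment has variance `e^u - e^v = e^u (1 - e^{-(u-v)})`; dividing by `e^{u/2}` leaves a
Gaussian variable of variance close to one. -/
lemma IsRegularBrownian.measure_increment (hB : IsRegularBrownian B P) {u v : ℝ} (huv : v ≤ u)
    (y : ℝ) :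
    P {ω | Real.exp (u / 2) * y ≤ B (Real.exp u).toNNReal ω - B (Real.exp v).toNNReal ω} =
      gaussianReal 0 (1 - Real.exp (-(u - v))).toNNReal (Ici y) := by
  rw [hB.measure_sub_ge]
  have h1 : Real.exp (-(u - v)) ≤ 1 := Real.exp_le_one_iff.2 (by linarith)
  have h2 : nndist (Real.exp u).toNNReal.1 (Real.exp v).toNNReal.1 =
      .mk (Real.exp (u / 2) ^ 2) (sq_nonneg _) * (1 - Real.exp (-(u - v))).toNNReal := by
    ext
    rw [coe_nndist, NNReal.coe_mul, NNReal.coe_mk, Real.coe_toNNReal _ (by linarith), Real.dist_eq]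
    change |((Real.exp u).toNNReal : ℝ) - ((Real.exp v).toNNReal : ℝ)| = _
    rw [Real.coe_toNNReal _ (Real.exp_pos _).le, Real.coe_toNNReal _ (Real.exp_pos _).le,
      abs_of_nonneg (by have := Real.exp_le_exp.2 huv; linarith), ← Real.exp_nat_mul, mul_sub,
      ← Real.exp_add]
    push_cast
    ring_nf
  rw [h2]
  have h3 := gaussianReal_map_const_mul (μ := 0) (v := (1 - Real.exp (-(u - v))).toNNReal)
    (Real.exp (u / 2))
  rw [mul_zero] at h3
  rw [← h3, Measure.map_apply (by fun_prop) measurableSet_Ici]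
  congr 1
  ext x
  simp [Real.exp_pos]

/-- The loss against a standard normal tail is `y² e^{-g}`, since `1 / (2(1-η)) ≤ 1/2 + η` for `0 ≤
η ≤ 1/2`. The condition `g ≥ 1` ensures `η = e^{-(u-v)} ≤ 1/2`, hence a variance in `[1/2, 1]`. -/
lemma IsRegularBrownian.exists_le_measure_increment :
    ∃ c : ℝ, 0 < c ∧ ∀ {Ω : Type*} {_ : MeasurableSpace Ω} {P : Measure Ω} {B : ℝ≥0 → Ω → ℝ},
      IsRegularBrownian B P → ∀ u v g y : ℝ, 1 ≤ g → v + g ≤ u → 1 ≤ y →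
      ENNReal.ofReal (c / y * Real.exp (-(y ^ 2 / 2 + y ^ 2 * Real.exp (-g)))) ≤
      P {ω | Real.exp (u / 2) * y ≤ B (Real.exp u).toNNReal ω - B (Real.exp v).toNNReal ω} := by
  obtain ⟨c, hc, h⟩ := exists_le_gaussianReal_Ici
  refine ⟨c, hc, fun {Ω _ P B} hB u v g y hg hvu hy => ?_⟩
  rw [hB.measure_increment (by linarith)]
  have h0 : 0 < Real.exp (-(u - v)) := Real.exp_pos _
  have hη : Real.exp (-(u - v)) ≤ Real.exp (-g) := Real.exp_le_exp.2 (by linarith)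
  have hg2 : Real.exp (-g) ≤ 1 / 2 := by
    have h1 : Real.exp (-g) ≤ Real.exp (-1) := Real.exp_le_exp.2 (by linarith)
    have h2 : Real.exp (-1) * Real.exp 1 = 1 := by rw [← Real.exp_add]; simp
    have h3 := Real.add_one_le_exp (1 : ℝ)
    nlinarith [Real.exp_pos (-1)]
  set η := Real.exp (-(u - v)) with hηdef
  refine le_trans (ENNReal.ofReal_le_ofReal ?_) (h (1 - η).toNNReal ?_ ?_ y hy)
  · refine mul_le_mul_of_nonneg_left (Real.exp_le_exp.2 ?_) (by positivity)
    rw [Real.coe_toNNReal _ (by linarith), neg_div, neg_le_neg_iff, div_le_iff₀ (by linarith)]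
    have h4 : y ^ 2 * η ≤ y ^ 2 * Real.exp (-g) := by gcongr
    have h5 : 0 ≤ y ^ 2 * η := by positivity
    have h6 : (y ^ 2 / 2 + y ^ 2 * η) * (2 * (1 - η)) = y ^ 2 + y ^ 2 * η * (1 - 2 * η) := by ring
    have h7 : 0 ≤ y ^ 2 * η * (1 - 2 * η) := mul_nonneg h5 (by linarith)
    nlinarith
  · rw [← NNReal.coe_le_coe, Real.coe_toNNReal _ (by linarith)]; push_cast; linarith
  · rw [← NNReal.coe_le_coe, Real.coe_toNNReal _ (by linarith)]; push_cast; linarith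

/-- The autoregressive form of the process: the past enters only through a value damped by
`e^{-(u-v)/2}`. -/
lemma ouProcess_eq_increment_add (u v : ℝ) (ω : Ω) :
    ouProcess B u ω = Real.exp (-u / 2) *
      (B (Real.exp u).toNNReal ω - B (Real.exp v).toNNReal ω) +
      Real.exp (-(u - v) / 2) * ouProcess B v ω := by
  have : Real.exp (-(u - v) / 2) * Real.exp (-v / 2) = Real.exp (-u / 2) := by
    rw [← Real.exp_add]; ring_nf
  rw [ouProcess, ouProcess, ← mul_assoc, this]
  ring

/-- A large increment makes the process tall, if it was not too low before. -/
lemma le_ouProcess_of_increment {u v y b : ℝ} {ω : Ω}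
    (h : Real.exp (u / 2) * y ≤ B (Real.exp u).toNNReal ω - B (Real.exp v).toNNReal ω)
    (hb : |(ouProcess B v ω)| ≤ b) : y - Real.exp (-(u - v) / 2) * b ≤ ouProcess B u ω := by
  rw [ouProcess_eq_increment_add u v]
  have h1 : y ≤ Real.exp (-u / 2) *
      (B (Real.exp u).toNNReal ω - B (Real.exp v).toNNReal ω) := by
    calc y = Real.exp (-u / 2) * (Real.exp (u / 2) * y) := by
          rw [← mul_assoc, ← Real.exp_add]; ring_nf; simp
      _ ≤ _ := by gcongr
  have h2 : Real.exp (-(u - v) / 2) * (-b) ≤ Real.exp (-(u - v) / 2) * ouProcess B v ω := by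
    gcongr
    exact (abs_le.1 hb).1
  linarith

/-! ### Tall peaks of the Ornstein-Uhlenbeck process are thick -/

lemma eventually_mul_le_exp (C : ℝ) {δ : ℝ} (hδ : 0 < δ) :
    ∀ᶠ n : ℕ in atTop, C * n ≤ Real.exp (δ * n) := by
  filter_upwards [tendsto_natCast_atTop_atTop.eventually_ge_atTop (2 * C / δ ^ 2)] with n hn
  have h1 := Real.quadratic_le_exp_of_nonneg (x := δ * n) (by positivity)
  rw [div_le_iff₀ (by positivity)] at hn
  have hn0 : (0 : ℝ) ≤ n := by positivity
  have hδn : 0 ≤ δ * n := by positivity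
  nlinarith

/-- If all the successive increments on a grid of step `n` are small, this is an unlikely event. -/
lemma IsRegularBrownian.measure_forall_increment_lt (hB : IsRegularBrownian B P) {n : ℕ}
    (x y p : ℝ) (M : ℕ)
    (hp : ∀ u v : ℝ, v + n ≤ u → ENNReal.ofReal p ≤
      P {ω | Real.exp (u / 2) * y ≤ B (Real.exp u).toNNReal ω - B (Real.exp v).toNNReal ω}) :
    P {ω | ∀ j < M, B (Real.exp (x + (j + 1 : ℕ) * n)).toNNReal ω -
      B (Real.exp (x + j * n)).toNNReal ω < Real.exp ((x + (j + 1 : ℕ) * n) / 2) * y} ≤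
      ENNReal.ofReal (Real.exp (-(p * M))) := by
  have hP : IsProbabilityMeasure P := hB.pre.isGaussianProcess.isProbabilityMeasure
  let t : ℕ → ℝ≥0 := fun j => (Real.exp (x + j * n)).toNNReal
  have ht : Monotone t := fun i j hij => by
    refine Real.toNNReal_le_toNNReal (Real.exp_le_exp.2 ?_)
    gcongr
  have hi := (hB.pre.hasIndepIncrements.nat ht).measure_inter_preimage_eq_mul (Finset.range M)
    (sets := fun j => Iio (Real.exp ((x + (j + 1 : ℕ) * n) / 2) * y))
    (fun j _ => measurableSet_Iio)
  have hset : {ω | ∀ j < M, B (Real.exp (x + (j + 1 : ℕ) * n)).toNNReal ω -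
      B (Real.exp (x + j * n)).toNNReal ω < Real.exp ((x + (j + 1 : ℕ) * n) / 2) * y} =
      ⋂ j ∈ Finset.range M, (fun ω => B (t (j + 1)) ω - B (t j) ω) ⁻¹'
        Iio (Real.exp ((x + (j + 1 : ℕ) * n) / 2) * y) := by
    ext ω; simp [t]
  rw [hset, hi]
  have hj : ∀ j ∈ Finset.range M, P ((fun ω => B (t (j + 1)) ω - B (t j) ω) ⁻¹'
      Iio (Real.exp ((x + (j + 1 : ℕ) * n) / 2) * y)) ≤ ENNReal.ofReal (Real.exp (-p)) := by
    intro j _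
    have h1 := hp (x + (j + 1 : ℕ) * n) (x + j * n) (by push_cast; linarith)
    have h2 : (fun ω => B (t (j + 1)) ω - B (t j) ω) ⁻¹'
      Iio (Real.exp ((x + (j + 1 : ℕ) * n) / 2) * y) =
      {ω | Real.exp ((x + (j + 1 : ℕ) * n) / 2) * y ≤ B (t (j + 1)) ω - B (t j) ω}ᶜ := by
      ext ω; simp
    have h3 : MeasurableSet
        {ω | Real.exp ((x + (j + 1 : ℕ) * n) / 2) * y ≤ B (t (j + 1)) ω - B (t j) ω} :=
      measurableSet_le measurable_const ((hB.meas _).sub (hB.meas _))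
    rw [h2, prob_compl_eq_one_sub h3]
    refine (tsub_le_tsub_left h1 1).trans ?_
    rw [tsub_le_iff_right, ← ENNReal.ofReal_one]
    refine le_trans (ENNReal.ofReal_le_ofReal ?_) ENNReal.ofReal_add_le
    linarith [Real.add_one_le_exp (-p)]
  refine (Finset.prod_le_prod' hj).trans (le_of_eq ?_)
  rw [Finset.prod_const, Finset.card_range, ← ENNReal.ofReal_pow (Real.exp_pos _).le,
    ← Real.exp_nat_mul]
  ring_nf

/-- The threshold `y = γ √(2(n+1)) + 1` has `y² / 2 = γ² n + O(√n)`. All corrections, including the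
logarithm of the prefactor, are of lower order than `(κ - γ²) n`. The added `1` in `y` is the
allowance for the damped past. -/
lemma eventually_threshold_le {γ κ c : ℝ} (hγ : 0 < γ) (hκ : γ ^ 2 < κ) (hc : 0 < c) :
    ∀ᶠ n : ℕ in atTop, Real.exp (-(κ * n)) ≤ c / (γ * √(2 * (n + 1 : ℕ)) + 1) *
      Real.exp (-((γ * √(2 * (n + 1 : ℕ)) + 1) ^ 2 / 2 +
        (γ * √(2 * (n + 1 : ℕ)) + 1) ^ 2 * Real.exp (-n))) := by
  set b := γ * √2 with hb
  have hb0 : 0 < b := by positivity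
  have hb2 : b ^ 2 = 2 * γ ^ 2 := by rw [hb, mul_pow, Real.sq_sqrt (by norm_num)]; ring
  set δ := κ - γ ^ 2 with hδ
  have hδ0 : 0 < δ := by linarith
  set K := 3 / 2 + (b + 1) ^ 2 - Real.log c + κ with hK
  have hlim : Tendsto (fun n : ℕ => √((n : ℝ) + 1)) atTop atTop :=
    Real.tendsto_sqrt_atTop.comp (tendsto_atTop_add_const_right _ _ tendsto_natCast_atTop_atTop)
  filter_upwards [hlim.eventually_ge_atTop 1,
    hlim.eventually_ge_atTop ((2 * b + |K|) / δ)] with n h1 h2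
  set r := √((n : ℝ) + 1) with hr
  have hr2 : r ^ 2 = n + 1 := Real.sq_sqrt (by positivity)
  have hy : γ * √(2 * (n + 1 : ℕ)) + 1 = b * r + 1 := by
    push_cast
    rw [Real.sqrt_mul (by norm_num), hb, hr]; ring
  rw [hy]
  have hy0 : 0 < b * r + 1 := by positivity
  have h3 : c / (b * r + 1) = Real.exp (Real.log c - Real.log (b * r + 1)) := by
    rw [Real.exp_sub, Real.exp_log hc, Real.exp_log hy0]
  rw [h3, ← Real.exp_add]
  refine Real.exp_le_exp.2 ?_
  have h4 : Real.log (b * r + 1) ≤ b * r := by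
    have := Real.log_le_sub_one_of_pos hy0; linarith
  have h5 : (b * r + 1) ^ 2 * Real.exp (-n) ≤ (b + 1) ^ 2 := by
    have h6 : Real.exp (-n) * (n + 1) ≤ 1 := by
      have h7 : Real.exp (-(n : ℝ)) * Real.exp n = 1 := by rw [← Real.exp_add]; simp
      have h8 := Real.add_one_le_exp (n : ℝ)
      nlinarith [Real.exp_pos (-(n : ℝ))]
    have h9 : (b * r + 1) ^ 2 ≤ ((b + 1) * r) ^ 2 := by
      refine pow_le_pow_left₀ hy0.le ?_ 2
      nlinarith
    calc (b * r + 1) ^ 2 * Real.exp (-n) ≤ ((b + 1) * r) ^ 2 * Real.exp (-n) := by gcongr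
      _ = (b + 1) ^ 2 * (Real.exp (-n) * (n + 1)) := by rw [mul_pow, hr2]; ring
      _ ≤ (b + 1) ^ 2 * 1 := by gcongr
      _ = _ := mul_one _
  rw [div_le_iff₀ hδ0] at h2
  have h10 : 2 * b * r + K ≤ δ * r ^ 2 := by
    have := le_abs_self K
    have := abs_nonneg K
    nlinarith
  have h11 : (b * r + 1) ^ 2 / 2 = γ ^ 2 * (n + 1) + b * r + 1 / 2 := by
    rw [← hr2]
    have : (b * r + 1) ^ 2 = b ^ 2 * r ^ 2 + 2 * (b * r) + 1 := by ring
    rw [this, hb2]; ring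
  have h12 : δ * r ^ 2 = κ * n + κ - γ ^ 2 * (n + 1) := by rw [hr2, hδ]; ring
  rw [h11]
  linarith

/-- Number of grid steps in a cell of the `n`-th shell. -/
noncomputable def stepCount (θ : ℝ) (n : ℕ) : ℕ := ⌈Real.exp (θ * n)⌉₊

/-- Length of the cells of the `n`-th shell. -/
noncomputable def cellLength (θ : ℝ) (n : ℕ) : ℝ := n * (stepCount θ n + 1)

/-- Indices of the cells contained in the positive part of the `n`-th shell. -/
noncomputable def cellIndices (θ : ℝ) (n : ℕ) : Finset ℕ :=
  Finset.Ico ⌈Real.exp n / cellLength θ n⌉₊ ⌊Real.exp (n + 1 : ℕ) / cellLength θ n⌋₊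

lemma one_le_cellLength (θ : ℝ) {n : ℕ} (hn : 1 ≤ n) : 1 ≤ cellLength θ n := by
  have : (1 : ℝ) ≤ n := by exact_mod_cast hn
  have h2 : (0 : ℝ) ≤ stepCount θ n := by positivity
  rw [cellLength]; nlinarith

lemma cellLength_le {θ : ℝ} (hθ : 0 ≤ θ) (n : ℕ) :
    cellLength θ n ≤ 3 * n * Real.exp (θ * n) := by
  have h1 : 1 ≤ Real.exp (θ * n) := Real.one_le_exp (by positivity)
  have h2 := Nat.ceil_lt_add_one (Real.exp_pos (θ * n)).le
  have hn : (0 : ℝ) ≤ n := by positivity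
  rw [cellLength, stepCount]
  nlinarith

lemma mem_cellIndices {θ : ℝ} {n a : ℕ} (hn : 1 ≤ n) (ha : a ∈ cellIndices θ n) :
    Real.exp n ≤ a * cellLength θ n ∧ (a + 1) * cellLength θ n ≤ Real.exp (n + 1 : ℕ) := by
  have hL : 0 < cellLength θ n := by linarith [one_le_cellLength θ hn]
  obtain ⟨h1, h2⟩ := Finset.mem_Ico.1 ha
  rw [Nat.ceil_le, div_le_iff₀ hL] at h1
  have h3 := (Nat.le_floor_iff (by positivity)).1 (Nat.succ_le_of_lt h2)
  rw [le_div_iff₀ hL] at h3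
  push_cast at h3
  exact ⟨h1, by exact_mod_cast h3⟩

lemma card_cellIndices_le {θ : ℝ} {n : ℕ} (hn : 1 ≤ n) :
    ((cellIndices θ n).card : ℝ) ≤ Real.exp (n + 1 : ℕ) := by
  have hL := one_le_cellLength θ hn
  rw [cellIndices, Nat.card_Ico]
  calc ((⌊Real.exp (n + 1 : ℕ) / cellLength θ n⌋₊ - ⌈Real.exp n / cellLength θ n⌉₊ : ℕ) : ℝ)
      ≤ (⌊Real.exp (n + 1 : ℕ) / cellLength θ n⌋₊ : ℝ) := by exact_mod_cast Nat.sub_le _ _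
    _ ≤ Real.exp (n + 1 : ℕ) / cellLength θ n := Nat.floor_le (by positivity)
    _ ≤ _ := div_le_self (Real.exp_pos _).le hL

lemma le_card_cellIndices {θ : ℝ} {n : ℕ} (hn : 1 ≤ n) :
    Real.exp (n + 1 : ℕ) / cellLength θ n / 2 - 2 ≤ (cellIndices θ n).card := by
  have hL := one_le_cellLength θ hn
  have h1 := Nat.lt_floor_add_one (Real.exp (n + 1 : ℕ) / cellLength θ n)
  have h2 := Nat.ceil_lt_add_one (a := Real.exp n / cellLength θ n) (by positivity)
  have h3 : Real.exp n / cellLength θ n ≤ Real.exp (n + 1 : ℕ) / cellLength θ n / 2 := by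
    rw [div_right_comm]
    refine div_le_div_of_nonneg_right ?_ (by linarith)
    push_cast
    rw [Real.exp_add]
    nlinarith [Real.add_one_le_exp (1 : ℝ), Real.exp_pos n]
  rw [cellIndices, Nat.card_Ico]
  have h4 : ((⌊Real.exp (n + 1 : ℕ) / cellLength θ n⌋₊ : ℝ) - ⌈Real.exp n / cellLength θ n⌉₊) ≤
      ((⌊Real.exp (n + 1 : ℕ) / cellLength θ n⌋₊ - ⌈Real.exp n / cellLength θ n⌉₊ : ℕ) : ℝ) := by
    rw [sub_le_iff_le_add]
    exact_mod_cast le_tsub_add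
  linarith

/-- Almost surely, all cells of large index contain a large increment. -/
lemma IsRegularBrownian.eventually_exists_increment (hB : IsRegularBrownian B P) {γ θ : ℝ}
    (hγ : 0 < γ) (hθ : γ ^ 2 < θ) :
    ∀ᵐ ω ∂P, ∀ᶠ n : ℕ in atTop, ∀ a ∈ cellIndices θ n, ∃ j < stepCount θ n,
      Real.exp ((a * cellLength θ n + (j + 1 : ℕ) * n) / 2) * (γ * √(2 * (n + 1 : ℕ)) + 1) ≤
      B (Real.exp (a * cellLength θ n + (j + 1 : ℕ) * n)).toNNReal ω -
      B (Real.exp (a * cellLength θ n + j * n)).toNNReal ω := by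
  obtain ⟨c, hc, hinc⟩ := IsRegularBrownian.exists_le_measure_increment
  set κ := (γ ^ 2 + θ) / 2 with hκ
  set δ := θ - κ with hδ
  have hδ0 : 0 < δ := by linarith
  let bad : ℕ → Set Ω := fun n => ⋃ a ∈ cellIndices θ n, {ω | ∀ j < stepCount θ n,
      B (Real.exp (a * cellLength θ n + (j + 1 : ℕ) * n)).toNNReal ω -
      B (Real.exp (a * cellLength θ n + j * n)).toNNReal ω <
      Real.exp ((a * cellLength θ n + (j + 1 : ℕ) * n) / 2) * (γ * √(2 * (n + 1 : ℕ)) + 1)}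
  have hbad : ∀ᶠ n : ℕ in atTop, P (bad n) ≤
      ENNReal.ofReal (Real.exp (1 + 2 / δ ^ 2) * Real.exp (-1 * n)) := by
    filter_upwards [eventually_threshold_le hγ (by linarith : γ ^ 2 < κ) hc,
      eventually_ge_atTop 1] with n hn hn1
    have hn1' : (1 : ℝ) ≤ n := by exact_mod_cast hn1
    refine (measure_biUnion_finset_le _ _).trans ?_
    have hcell : ∀ a ∈ cellIndices θ n, P {ω | ∀ j < stepCount θ n,
      B (Real.exp (a * cellLength θ n + (j + 1 : ℕ) * n)).toNNReal ω -
      B (Real.exp (a * cellLength θ n + j * n)).toNNReal ω <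
      Real.exp ((a * cellLength θ n + (j + 1 : ℕ) * n) / 2) * (γ * √(2 * (n + 1 : ℕ)) + 1)} ≤
        ENNReal.ofReal (Real.exp (-Real.exp (δ * n))) := by
      intro a _
      refine (hB.measure_forall_increment_lt _ _ (Real.exp (-(κ * n))) _ fun u v huv => ?_).trans ?_
      · refine (ENNReal.ofReal_le_ofReal hn).trans (hinc hB u v n _ hn1' huv ?_)
        have : 0 ≤ γ * √(2 * (n + 1 : ℕ)) := by positivity
        linarith
      · refine ENNReal.ofReal_le_ofReal (Real.exp_le_exp.2 (neg_le_neg ?_))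
        have := Nat.le_ceil (Real.exp (θ * n))
        calc Real.exp (δ * n) = Real.exp (-(κ * n)) * Real.exp (θ * n) := by
              rw [← Real.exp_add, hδ]; ring_nf
          _ ≤ _ := by rw [stepCount]; gcongr
    refine (Finset.sum_le_sum hcell).trans ?_
    rw [Finset.sum_const, nsmul_eq_mul, ← ENNReal.ofReal_natCast,
      ← ENNReal.ofReal_mul (by positivity)]
    refine ENNReal.ofReal_le_ofReal ?_
    refine (mul_le_mul_of_nonneg_right (card_cellIndices_le hn1) (Real.exp_pos _).le).trans ?_
    rw [← Real.exp_add, ← Real.exp_add]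
    refine Real.exp_le_exp.2 ?_
    -- There are at most `e^{n+1}` cells, each failing with probability at most `exp(-e^{δn})`. The
    -- bounds `e^{δn} ≥ (δn)²/2 ≥ 2n - 2/δ²`, the latter by completing the square, make the union
    -- bound summable.
    have h1 := Real.quadratic_le_exp_of_nonneg (x := δ * n) (by positivity)
    have h2 : 2 * (n : ℝ) - 2 / δ ^ 2 ≤ (δ * n) ^ 2 / 2 := by
      have h3 : (δ * n) ^ 2 / 2 - 2 * (n : ℝ) + 2 / δ ^ 2 = (δ * n - 2 / δ) ^ 2 / 2 := by
        field_simp; ring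
      nlinarith [sq_nonneg (δ * n - 2 / δ)]
    have h4 : 0 ≤ δ * n := by positivity
    push_cast
    linarith
  obtain ⟨N, hN⟩ := eventually_atTop.1 hbad
  have hsum : ∑' n, P (bad (n + N)) ≠ ∞ := by
    refine ne_top_of_le_ne_top ?_ ((ENNReal.tsum_le_tsum fun n => hN (n + N) (by omega)).trans
      (tsum_add_le_tsum N fun n => ENNReal.ofReal (Real.exp (1 + 2 / δ ^ 2) * Real.exp (-1 * n))))
    exact tsum_ofReal_exp_mul_ne_top _ (by norm_num)
  filter_upwards [ae_eventually_notMem hsum] with ω hω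
  rw [eventually_atTop] at hω ⊢
  obtain ⟨m, hm⟩ := hω
  refine ⟨m + N, fun n hn a ha => ?_⟩
  have h := hm (n - N) (by omega)
  rw [Nat.sub_add_cancel (by omega)] at h
  by_contra! hcon
  exact h (mem_iUnion₂.2 ⟨a, ha, hcon⟩)

lemma IsRegularBrownian.le_macroDim (hB : IsRegularBrownian B P) {γ θ : ℝ}
    (hγ : 0 < γ) (hθ : γ ^ 2 < θ) :
    ∀ᵐ ω ∂P, ∀ E : Set ℝ,
      (∀ᶠ s in atTop, γ * √(2 * Real.log s) ≤ ouProcess B s ω → s ∈ E) →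
      ENNReal.ofReal (1 - θ) ≤ macroDim E := by
  have hθ0 : 0 < θ := lt_trans (by positivity) hθ
  filter_upwards [hB.eventually_exists_increment hγ hθ,
    hB.eventually_abs_ouProcess_lt one_lt_two] with ω hω hup E hE
  refine le_macroDim_of_tsum fun ρ hρ hρθ => ?_
  -- A convergent series would have terms tending to zero, whereas the contents stay above `1/12`.
  by_contra hfin
  have hzero := (ENNReal.tendsto_atTop_zero_of_tsum_ne_top hfin).eventually_lt_const
    (show (0 : ℝ≥0∞) < ENNReal.ofReal (1 / 12) by simp)
  obtain ⟨R, hR⟩ := eventually_atTop.1 (hE.and hup)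
  have hexp : ∀ᶠ n : ℕ in atTop, R ≤ Real.exp n :=
    (Real.tendsto_exp_atTop.comp tendsto_natCast_atTop_atTop).eventually_ge_atTop R
  -- Since the cell length `L` is at most `3n e^{θn}`, these give in turn `L ≤ e^{(1-ρ)n}`, `8 L ≤
  -- e^{n+1}`, and `8(n+1) ≤ 16n ≤ e^n`, the last making the damped past at most `1`.
  have hlen := eventually_mul_le_exp 3 (δ := 1 - ρ - θ) (by linarith)
  have hlen2 := eventually_mul_le_exp 24 (δ := 1 - θ) (by linarith)
  have hdec := eventually_mul_le_exp 16 one_pos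
  obtain ⟨n, h1, h2, h3, h4, h5, h6, h7⟩ := (hzero.and <| hω.and <| hexp.and <| hlen.and <|
    hlen2.and <| hdec.and <| eventually_ge_atTop 1).exists
  have hn1 : (1 : ℝ) ≤ n := by exact_mod_cast h7
  have hL1 := one_le_cellLength θ h7
  have hL0 : 0 < cellLength θ n := by linarith
  have hcell : ∀ a ∈ cellIndices θ n, ∃ p : ℝ, p ∈ E ∧ a * cellLength θ n ≤ p ∧
      p < (a + 1) * cellLength θ n := by
    intro a ha
    obtain ⟨ha1, ha2⟩ := mem_cellIndices h7 ha
    obtain ⟨j, hj, hinc⟩ := h2 a ha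
    have hj' : ((j : ℝ) + 1) ≤ stepCount θ n := by exact_mod_cast hj
    have hp1 : a * cellLength θ n ≤ a * cellLength θ n + (j + 1 : ℕ) * n := by
      have : (0 : ℝ) ≤ (j + 1 : ℕ) * n := by positivity
      linarith
    -- The extra step in `cellLength` keeps the last grid point strictly inside the cell.
    have hp2 : a * cellLength θ n + (j + 1 : ℕ) * n < (a + 1) * cellLength θ n := by
      push_cast
      have : ((j : ℝ) + 1) * n ≤ stepCount θ n * n := by gcongr
      rw [cellLength]
      nlinarith
    set s : ℝ := a * cellLength θ n + (j + 1 : ℕ) * n with hs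
    set s' : ℝ := a * cellLength θ n + j * n with hs'
    have hs's : s' ≤ s := by rw [hs, hs']; push_cast; nlinarith
    have hs'1 : a * cellLength θ n ≤ s' := by
      have : (0 : ℝ) ≤ j * n := by positivity
      linarith
    have hlog : ∀ z : ℝ, 0 < z → z ≤ s → Real.log z ≤ (n + 1 : ℕ) := fun z hz hzs => by
      rw [Real.log_le_iff_le_exp hz]; linarith
    have hexp0 := Real.exp_pos (n : ℝ)
    refine ⟨s, (hR s (by linarith)).1 ?_, hp1, hp2⟩
    have hb : |(ouProcess B s' ω)| ≤ 2 * √(2 * (n + 1 : ℕ)) := by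
      refine (hR s' (by linarith)).2.le.trans ?_
      gcongr
      exact hlog _ (by linarith) hs's
    have hU := le_ouProcess_of_increment hinc hb
    have hsub : s - s' = n := by rw [hs, hs']; push_cast; ring
    rw [hsub] at hU
    have hsmall : Real.exp (-n / 2) * (2 * √(2 * (n + 1 : ℕ))) ≤ 1 := by
      have h8 : 2 * √(2 * (n + 1 : ℕ)) = √(8 * (n + 1)) := by
        rw [show (8 : ℝ) * (n + 1) = 2 ^ 2 * (2 * (n + 1 : ℕ)) by push_cast; ring,
          Real.sqrt_mul (sq_nonneg 2), Real.sqrt_sq (by norm_num)]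
      rw [h8]
      have h9 : √(8 * ((n : ℝ) + 1)) ≤ Real.exp (n / 2) := by
        rw [Real.sqrt_le_iff]
        refine ⟨(Real.exp_pos _).le, ?_⟩
        rw [← Real.exp_nat_mul]
        push_cast
        rw [one_mul] at h6
        have : (2 : ℝ) * (n / 2) = n := by ring
        rw [this]; linarith
      calc Real.exp (-n / 2) * √(8 * ((n : ℝ) + 1)) ≤ Real.exp (-n / 2) * Real.exp (n / 2) := by
            gcongr
        _ = 1 := by rw [← Real.exp_add]; ring_nf; simp
    have hfinal : γ * √(2 * Real.log s) ≤ γ * √(2 * (n + 1 : ℕ)) := by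
      gcongr
      exact hlog _ (by linarith) le_rfl
    linarith
  choose! p hpE hp1 hp2 using hcell
  have hLle : cellLength θ n ≤ Real.exp ((1 - ρ) * n) := by
    refine (cellLength_le hθ0.le n).trans ?_
    calc 3 * n * Real.exp (θ * n) ≤ Real.exp ((1 - ρ - θ) * n) * Real.exp (θ * n) := by gcongr
      _ = _ := by rw [← Real.exp_add]; ring_nf
  have hcontent := le_shellContent_of_cells (n := n) (ρ := ρ) (E := E) (L := cellLength θ n)
    (N := Real.exp (n + 1 : ℕ) / cellLength θ n) hρ (by linarith) hL0 le_rfl ?_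
    (cellIndices θ n) p (fun a ha => ⟨hp1 a ha, hp2 a ha⟩) hpE
    (fun a ha => ⟨(mem_cellIndices h7 ha).1.trans (hp1 a ha),
      (hp2 a ha).trans_le (mem_cellIndices h7 ha).2⟩)
  · refine absurd (hcontent.trans_lt h1) (not_lt.2 (ENNReal.ofReal_le_ofReal ?_))
    -- With `N = e^{n+1} / L ≥ 8` there are at least `N/2 - 2 ≥ N/4` cells, and the content is at
    -- least the number of cells over `3N`, hence at least `1/12`.
    have hcard := le_card_cellIndices (θ := θ) h7
    have hbig : 8 ≤ Real.exp (n + 1 : ℕ) / cellLength θ n := by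
      rw [le_div_iff₀ hL0]
      have h8 := cellLength_le hθ0.le n
      have h9 : 24 * n * Real.exp (θ * n) ≤ Real.exp n := by
        calc 24 * n * Real.exp (θ * n) ≤ Real.exp ((1 - θ) * n) * Real.exp (θ * n) := by gcongr
          _ = _ := by rw [← Real.exp_add]; ring_nf
      have h10 : Real.exp n ≤ Real.exp (n + 1 : ℕ) := Real.exp_le_exp.2 (by push_cast; linarith)
      linarith
    rw [le_div_iff₀ (by linarith)]
    linarith
  · rw [le_div_iff₀ hL0, ← Real.exp_mul]
    calc Real.exp ((n + 1 : ℕ) * ρ) * cellLength θ n ≤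
          Real.exp ((n + 1 : ℕ) * ρ) * Real.exp ((1 - ρ) * n) := by gcongr
      _ ≤ _ := by
          rw [← Real.exp_add]
          refine Real.exp_le_exp.2 ?_
          push_cast
          nlinarith

/-! ### The critical level: tall peaks of Brownian motion have full dimension -/

/-- A Borel-Cantelli lemma for sums of independent variables with values in `[0, 1]`. -/
lemma ae_tsum_ofReal_eq_top [IsProbabilityMeasure P] {X : ℕ → Ω → ℝ} (hm : ∀ k, Measurable (X k))
    (h0 : ∀ k ω, 0 ≤ X k ω) (h1 : ∀ k ω, X k ω ≤ 1)
    (hind : ∀ n, IndepFun (fun ω => ∑ k ∈ Finset.range n, X k ω) (X n) P)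
    (hsum : Tendsto (fun n => ∑ k ∈ Finset.range n, ∫ ω, X k ω ∂P) atTop atTop) :
    ∀ᵐ ω ∂P, ∑' k, ENNReal.ofReal (X k ω) = ∞ := by
  have hS : ∀ n, Measurable fun ω => ∑ k ∈ Finset.range n, X k ω := fun n =>
    Finset.measurable_fun_sum _ fun k _ => hm k
  have hXint : ∀ k, Integrable (X k) P := fun k =>
    Integrable.of_bound (hm k).aestronglyMeasurable 1
      (.of_forall fun ω => by rw [Real.norm_of_nonneg (h0 k ω)]; exact h1 k ω)
  have hmgf1 : ∀ k, mgf (X k) P (-1) ≤ Real.exp (-(∫ ω, X k ω ∂P) / 2) := by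
    intro k
    -- On `[0, 1]`, `e^{-x} ≤ 1 / (1 + x) ≤ 1 - x/2`. Thus the Laplace transform of the partial sums
    -- at `-1` is at most `e^{-(sum of means)/2}`, and Chernoff's bound excludes a bounded sum.
    have hle : ∀ ω, Real.exp (-1 * X k ω) ≤ 1 - X k ω / 2 := by
      intro ω
      have hx0 := h0 k ω
      have hx1 := h1 k ω
      have hpos := Real.exp_pos (-1 * X k ω)
      have hinv : Real.exp (-1 * X k ω) * Real.exp (X k ω) = 1 := by
        rw [← Real.exp_add]; ring_nf; simp
      have hge := Real.add_one_le_exp (X k ω)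
      nlinarith
    have hint : Integrable (fun ω => Real.exp (-1 * X k ω)) P :=
      Integrable.of_bound (by have := hm k; fun_prop) 1 (.of_forall fun ω => by
        rw [Real.norm_of_nonneg (Real.exp_pos _).le, Real.exp_le_one_iff]
        linarith [h0 k ω])
    calc mgf (X k) P (-1) ≤ ∫ ω, (1 - X k ω / 2) ∂P :=
          integral_mono hint ((integrable_const _).sub ((hXint k).div_const 2)) hle
      _ = 1 - (∫ ω, X k ω ∂P) / 2 := by
          rw [integral_sub (integrable_const _) ((hXint k).div_const 2), integral_div]; simp
      _ ≤ _ := by linarith [Real.add_one_le_exp (-(∫ ω, X k ω ∂P) / 2)]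
  have hmgf : ∀ n, mgf (fun ω => ∑ k ∈ Finset.range n, X k ω) P (-1) ≤
      Real.exp (-(∑ k ∈ Finset.range n, ∫ ω, X k ω ∂P) / 2) := by
    intro n
    induction n with
    | zero => simp [mgf]
    | succ n ih =>
      have h2 : (fun ω => ∑ k ∈ Finset.range (n + 1), X k ω) =
          (fun ω => ∑ k ∈ Finset.range n, X k ω) + X n := by
        ext ω; simp [Finset.sum_range_succ]
      have hSn := hS n
      have hXn := hm n
      rw [h2, (hind n).mgf_add (by fun_prop) (by fun_prop), Finset.sum_range_succ]
      refine (mul_le_mul ih (hmgf1 n) mgf_nonneg (Real.exp_pos _).le).trans (le_of_eq ?_)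
      rw [← Real.exp_add]; ring_nf
  have hnull : ∀ K : ℕ, ∀ᵐ ω ∂P, ∃ n, (K : ℝ) < ∑ k ∈ Finset.range n, X k ω := by
    intro K
    have hb : ∀ n, P.real {ω | ∀ n, ∑ k ∈ Finset.range n, X k ω ≤ (K : ℝ)} ≤
        Real.exp K * Real.exp (-(∑ k ∈ Finset.range n, ∫ ω, X k ω ∂P) / 2) := by
      intro n
      have hSn := hS n
      have hint : Integrable (fun ω => Real.exp (-1 * ∑ k ∈ Finset.range n, X k ω)) P :=
        Integrable.of_bound (by fun_prop) 1 (.of_forall fun ω => by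
          rw [Real.norm_of_nonneg (Real.exp_pos _).le, Real.exp_le_one_iff]
          have : 0 ≤ ∑ k ∈ Finset.range n, X k ω := Finset.sum_nonneg fun k _ => h0 k ω
          linarith)
      have h3 := measure_le_le_exp_mul_mgf (μ := P) (X := fun ω => ∑ k ∈ Finset.range n, X k ω)
        (t := -1) (K : ℝ) (by norm_num) hint
      refine le_trans (measureReal_mono fun ω hω => hω n) (h3.trans ?_)
      rw [neg_neg, one_mul]
      exact mul_le_mul_of_nonneg_left (hmgf n) (Real.exp_pos _).le
    have hlim : Tendsto (fun n => Real.exp K *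
        Real.exp (-(∑ k ∈ Finset.range n, ∫ ω, X k ω ∂P) / 2)) atTop (nhds (Real.exp K * 0)) := by
      refine Tendsto.const_mul _ (Real.tendsto_exp_atBot.comp ?_)
      exact (tendsto_neg_atTop_atBot.comp hsum).atBot_div_const two_pos
    have h0' := ge_of_tendsto' hlim hb
    rw [mul_zero] at h0'
    have h4 : P {ω | ∀ n, ∑ k ∈ Finset.range n, X k ω ≤ (K : ℝ)} = 0 := by
      rw [← measureReal_eq_zero_iff]
      exact le_antisymm h0' measureReal_nonneg
    rw [ae_iff]
    push Not
    exact h4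
  filter_upwards [ae_all_iff.2 hnull] with ω hω
  by_contra hne
  obtain ⟨K, hK⟩ := exists_nat_gt (∑' k, ENNReal.ofReal (X k ω)).toReal
  obtain ⟨n, hn⟩ := hω K
  have h5 : ENNReal.ofReal (∑ k ∈ Finset.range n, X k ω) ≤ ∑' k, ENNReal.ofReal (X k ω) := by
    rw [ENNReal.ofReal_sum_of_nonneg fun k _ => h0 k ω]
    exact ENNReal.sum_le_tsum _
  have h6 := (ENNReal.ofReal_le_iff_le_toReal hne).1 h5
  linarith

/-- Comparison with the telescoping sum of `log log (n+1) - log log n ≤ 1 / (n log n)`. The terms at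
`0` and `1` vanish, being divisions by zero. -/
lemma tendsto_sum_one_div_mul_log :
    Tendsto (fun n : ℕ => ∑ k ∈ Finset.range n, 1 / ((k : ℝ) * Real.log k)) atTop atTop := by
  have hstep : ∀ n : ℕ, 2 ≤ n → Real.log (Real.log n) - Real.log (Real.log 2) ≤
      ∑ k ∈ Finset.range n, 1 / ((k : ℝ) * Real.log k) := by
    intro n hn
    induction n, hn using Nat.le_induction with
    | base => simp [Finset.sum_range_succ]
    | succ n hn ih =>
      rw [Finset.sum_range_succ]
      have hn2 : (2 : ℝ) ≤ n := by exact_mod_cast hn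
      have hl : 0 < Real.log n := Real.log_pos (by linarith)
      have hl1 : 0 < Real.log (n + 1 : ℕ) := Real.log_pos (by push_cast; linarith)
      have h1 : Real.log (n + 1 : ℕ) - Real.log n ≤ 1 / n := by
        rw [← Real.log_div (by positivity) (by positivity)]
        refine (Real.log_le_sub_one_of_pos (by positivity)).trans (le_of_eq ?_)
        push_cast; field_simp; ring
      have h2 : Real.log (Real.log (n + 1 : ℕ)) - Real.log (Real.log n) ≤
          1 / ((n : ℝ) * Real.log n) := by
        rw [← Real.log_div hl1.ne' hl.ne']
        refine (Real.log_le_sub_one_of_pos (by positivity)).trans ?_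
        rw [div_sub_one hl.ne', ← div_div]
        gcongr
      linarith
  refine tendsto_atTop_mono' atTop ((eventually_ge_atTop 2).mono hstep) ?_
  exact tendsto_atTop_add_const_right _ _
    (Real.tendsto_log_atTop.comp (Real.tendsto_log_atTop.comp tendsto_natCast_atTop_atTop))

/-- The length, on the exponential scale, of the gap before the `k`-th observation window. -/
noncomputable def gap (k : ℕ) : ℕ := ⌈2 * Real.posLog (Real.posLog k)⌉₊ + 1

/-- The reference time, on the exponential scale, of the `k`-th observation window. -/
noncomputable def refTime (k : ℕ) : ℕ := k * (gap k + 1)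

/-- The integers in the `k`-th observation window. -/
noncomputable def obsWindow (k : ℕ) : Finset ℕ :=
  Finset.Ico ⌈Real.exp (refTime k + gap k : ℕ)⌉₊ ⌈Real.exp (refTime k + gap k + 1 : ℕ)⌉₊

/-- The level reached at the end of the `k`-th observation window. -/
noncomputable def obsLevel (k : ℕ) : ℝ := √(2 * Real.log (refTime k + gap k + 1 : ℕ))

/-- The threshold for increments over the `k`-th observation window. -/
noncomputable def obsThreshold (k : ℕ) : ℝ := obsLevel k + 2 * obsLevel k / Real.log k

lemma gap_mono : Monotone gap := by
  intro i j hij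
  refine Nat.add_le_add_right (Nat.ceil_le_ceil ?_) 1
  refine mul_le_mul_of_nonneg_left (Real.posLog_le_posLog Real.posLog_nonneg ?_) zero_le_two
  exact Real.posLog_le_posLog (by positivity) (by exact_mod_cast hij)

/-- Each window closes before the next reference time, because `refTime k + gap k + 1 = (k+1)(gap k
+ 1)` and the gaps increase. This separation gives the independence of the windows. -/
lemma refTime_succ (k : ℕ) : refTime k + gap k + 1 ≤ refTime (k + 1) := by
  have h := gap_mono (Nat.le_succ k)
  have : (k + 1) * (gap k + 1) ≤ (k + 1) * (gap (k + 1) + 1) :=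
    Nat.mul_le_mul_left _ (Nat.add_le_add_right h 1)
  simp only [refTime]
  linarith

lemma refTime_mono : Monotone refTime :=
  monotone_nat_of_le_succ fun k => by have := refTime_succ k; omega

lemma strictMono_refTime_add_gap : StrictMono fun k => refTime k + gap k :=
  strictMono_nat_of_lt_succ fun k => by have := refTime_succ k; omega

lemma le_refTime (k : ℕ) : k ≤ refTime k := Nat.le_mul_of_pos_right _ (Nat.succ_pos _)

lemma mem_obsWindow {k s : ℕ} (h : s ∈ obsWindow k) :
    Real.exp (refTime k + gap k : ℕ) ≤ s ∧ (s : ℝ) < Real.exp (refTime k + gap k + 1 : ℕ) := by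
  rw [obsWindow, Finset.mem_Ico, Nat.ceil_le, Nat.lt_ceil] at h
  exact h

lemma card_obsWindow_le (k : ℕ) :
    ((obsWindow k).card : ℝ) ≤ Real.exp (refTime k + gap k + 1 : ℕ) := by
  have h1 := Nat.ceil_lt_add_one (Real.exp_pos (refTime k + gap k + 1 : ℕ)).le
  have h2 : 1 ≤ ⌈Real.exp (refTime k + gap k : ℕ)⌉₊ := Nat.one_le_ceil_iff.2 (Real.exp_pos _)
  have h3 : (obsWindow k).card + 1 ≤ ⌈Real.exp (refTime k + gap k + 1 : ℕ)⌉₊ := by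
    have h4 : 1 ≤ ⌈Real.exp (refTime k + gap k + 1 : ℕ)⌉₊ := Nat.one_le_ceil_iff.2 (Real.exp_pos _)
    rw [obsWindow, Nat.card_Ico]; omega
  have h5 : ((obsWindow k).card : ℝ) + 1 ≤ ⌈Real.exp (refTime k + gap k + 1 : ℕ)⌉₊ := by
    exact_mod_cast h3
  linarith

lemma le_card_obsWindow (k : ℕ) :
    Real.exp (refTime k + gap k + 1 : ℕ) / 4 ≤ (obsWindow k).card := by
  have h1 := Nat.le_ceil (Real.exp (refTime k + gap k + 1 : ℕ))
  have h2 := Nat.ceil_lt_add_one (Real.exp_pos (refTime k + gap k : ℕ)).le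
  have h3 : (⌈Real.exp (refTime k + gap k + 1 : ℕ)⌉₊ : ℝ) - ⌈Real.exp (refTime k + gap k : ℕ)⌉₊ ≤
      (obsWindow k).card := by
    rw [obsWindow, Nat.card_Ico, sub_le_iff_le_add]
    exact_mod_cast le_tsub_add
  have h4 : 2 ≤ Real.exp (refTime k + gap k : ℕ) := by
    have h5 : (1 : ℝ) ≤ (refTime k + gap k : ℕ) := by
      exact_mod_cast (by rw [gap]; omega : 1 ≤ refTime k + gap k)
    linarith [Real.add_one_le_exp ((refTime k + gap k : ℕ) : ℝ)]
  have h6 : 2 * Real.exp (refTime k + gap k : ℕ) ≤ Real.exp (refTime k + gap k + 1 : ℕ) := by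
    rw [Nat.cast_succ, Real.exp_add]
    nlinarith [Real.add_one_le_exp (1 : ℝ), Real.exp_pos (refTime k + gap k : ℕ)]
  linarith

/-- Elementary estimates for the parameters of the observation windows. -/
lemma obs_estimates {k : ℕ} (hk : 196 ≤ k) :
    1 ≤ Real.log k ∧ Real.exp (-gap k / 2) ≤ 1 / Real.log k ∧ 1 ≤ obsLevel k ∧
    obsLevel k ^ 2 ≤ 4 * Real.log k ∧
    ((refTime k + gap k + 1 : ℕ) : ℝ) ≤ 14 * k * √(Real.log k) := by
  have hk' : (196 : ℝ) ≤ k := by exact_mod_cast hk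
  have hlog : 1 ≤ Real.log k := by
    rw [Real.le_log_iff_exp_le (by linarith)]
    linarith [Real.exp_one_lt_d9]
  have hll : 0 ≤ Real.log (Real.log k) := Real.log_nonneg hlog
  have hpos : Real.posLog (Real.posLog k) = Real.log (Real.log k) := by
    rw [Real.posLog_eq_log (x := (k : ℝ)) (by rw [abs_of_pos] <;> linarith),
      Real.posLog_eq_log (by rw [abs_of_pos] <;> linarith)]
  have hgap1 : 2 * Real.log (Real.log k) ≤ gap k := by
    rw [gap, hpos]
    push_cast
    linarith [Nat.le_ceil (2 * Real.log (Real.log k))]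
  have hgap2 : (gap k : ℝ) ≤ 2 * Real.log (Real.log k) + 2 := by
    rw [gap, hpos]
    push_cast
    linarith [Nat.ceil_lt_add_one (a := 2 * Real.log (Real.log k)) (by linarith)]
  have hsq : √(Real.log k) ^ 2 = Real.log k := Real.sq_sqrt (by linarith)
  have hsq1 : 1 ≤ √(Real.log k) := Real.one_le_sqrt.2 hlog
  have hlls : Real.log (Real.log k) ≤ 2 * √(Real.log k) := by
    have := Real.log_le_sub_one_of_pos (x := √(Real.log k)) (by linarith)
    rw [Real.log_sqrt (by linarith)] at this
    linarith
  have hn : ((refTime k + gap k + 1 : ℕ) : ℝ) = (k + 1) * (gap k + 1) := by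
    rw [refTime]; push_cast; ring
  -- Here `14 = 2 · 7`: `k + 1 ≤ 2k`, and `gap k + 1 ≤ 4 √(log k) + 3 ≤ 7 √(log k)`.
  have hn14 : ((refTime k + gap k + 1 : ℕ) : ℝ) ≤ 14 * k * √(Real.log k) := by
    rw [hn]
    calc ((k : ℝ) + 1) * (gap k + 1) ≤ (2 * k) * (7 * √(Real.log k)) := by
          gcongr
          · linarith
          · linarith
      _ = _ := by ring
  have hkn : (k : ℝ) ≤ (refTime k + gap k + 1 : ℕ) := by
    have := le_refTime k
    exact_mod_cast (by omega : k ≤ refTime k + gap k + 1)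
  have hlogn : Real.log k ≤ Real.log (refTime k + gap k + 1 : ℕ) :=
    Real.log_le_log (by linarith) hkn
  refine ⟨hlog, ?_, ?_, ?_, hn14⟩
  · rw [one_div, ← Real.exp_log (show 0 < (Real.log k)⁻¹ by positivity), Real.log_inv]
    exact Real.exp_le_exp.2 (by linarith)
  · rw [obsLevel, Real.one_le_sqrt]; linarith
  · rw [obsLevel, Real.sq_sqrt (by linarith)]
    have h1 : √(Real.log k) ≤ √k :=
      Real.sqrt_le_sqrt (by linarith [Real.log_le_sub_one_of_pos (x := (k : ℝ)) (by linarith)])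
    have h2 : √(k : ℝ) ^ 2 = k := Real.sq_sqrt (by linarith)
    -- This is where `196 = 14²` is needed: it makes the shell index at most `k²`, so its logarithm
    -- is at most `2 log k`.
    have h3 : 14 ≤ √(k : ℝ) := Real.le_sqrt_of_sq_le (by linarith)
    have h4 : ((refTime k + gap k + 1 : ℕ) : ℝ) ≤ (k : ℝ) ^ 2 := by
      refine hn14.trans ?_
      have h5 : 14 * √(Real.log k) ≤ k := by nlinarith
      nlinarith
    have h6 := Real.log_le_log (by linarith) h4
    rw [Real.log_pow] at h6
    push_cast at h6 ⊢
    linarith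

/-- The event of a large increment between the reference time and an observation time. -/
def incrementEvent (k s : ℕ) : Set (ℝ≥0 → ℝ) :=
  {w | Real.exp (Real.log s / 2) * obsThreshold k ≤
    w (Real.exp (Real.log s)).toNNReal - w (Real.exp (refTime k)).toNNReal}

lemma measurableSet_incrementEvent (k s : ℕ) : MeasurableSet (incrementEvent k s) :=
  measurableSet_le measurable_const (by fun_prop)

/-- The proportion of observation times with a large increment, as a function of the path. -/
noncomputable def obsProportion (k : ℕ) (w : ℝ≥0 → ℝ) : ℝ :=
  (∑ s ∈ obsWindow k, (incrementEvent k s).indicator 1 w) / Real.exp (refTime k + gap k + 1 : ℕ)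

lemma measurable_obsProportion (k : ℕ) : Measurable (obsProportion k) :=
  (Finset.measurable_fun_sum _ fun s _ =>
    measurable_one.indicator (measurableSet_incrementEvent k s)).div_const _

lemma obsProportion_congr {k : ℕ} {w w' : ℝ≥0 → ℝ} (h : ∀ s ∈ obsWindow k,
    w (Real.exp (Real.log s)).toNNReal - w (Real.exp (refTime k)).toNNReal =
    w' (Real.exp (Real.log s)).toNNReal - w' (Real.exp (refTime k)).toNNReal) :
    obsProportion k w = obsProportion k w' := by
  rw [obsProportion, obsProportion]
  congr 1
  refine Finset.sum_congr rfl fun s hs => ?_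
  have hiff : w ∈ incrementEvent k s ↔ w' ∈ incrementEvent k s := by
    simp only [incrementEvent, mem_ofPred_eq, h s hs]
  by_cases hw : w ∈ incrementEvent k s
  · rw [indicator_of_mem hw, indicator_of_mem (hiff.1 hw)]; rfl
  · rw [indicator_of_notMem hw, indicator_of_notMem (mt hiff.2 hw)]

lemma obsProportion_nonneg (k : ℕ) (w : ℝ≥0 → ℝ) : 0 ≤ obsProportion k w :=
  div_nonneg (Finset.sum_nonneg fun _ _ => indicator_nonneg (fun _ _ => zero_le_one) _)
    (Real.exp_pos _).le

lemma obsProportion_le_one (k : ℕ) (w : ℝ≥0 → ℝ) : obsProportion k w ≤ 1 := by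
  rw [obsProportion, div_le_one (Real.exp_pos _)]
  refine le_trans ?_ (card_obsWindow_le k)
  rw [Finset.card_eq_sum_ones]
  push_cast
  refine Finset.sum_le_sum fun s _ => ?_
  exact indicator_le_self' (fun _ _ => zero_le_one) _

lemma exp_log_toNNReal_bounds {k s : ℕ} (hs : s ∈ obsWindow k) :
    (Real.exp (refTime k)).toNNReal ≤ (Real.exp (Real.log s)).toNNReal ∧
    (Real.exp (Real.log s)).toNNReal ≤ (Real.exp (refTime (k + 1))).toNNReal := by
  obtain ⟨h1, h2⟩ := mem_obsWindow hs
  have hs0 : (0 : ℝ) < s := (Real.exp_pos _).trans_le h1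
  rw [Real.exp_log hs0]
  refine ⟨Real.toNNReal_le_toNNReal (le_trans (Real.exp_le_exp.2 ?_) h1),
    Real.toNNReal_le_toNNReal (h2.le.trans (Real.exp_le_exp.2 ?_))⟩
  · exact_mod_cast Nat.le_add_right _ _
  · exact_mod_cast refTime_succ k

lemma IsRegularBrownian.indepFun_obsProportion (hB : IsRegularBrownian B P) (n : ℕ) :
    IndepFun (fun ω => ∑ k ∈ Finset.range n, obsProportion k (B · ω))
      (fun ω => obsProportion n (B · ω)) P := by
  set t₀ := (Real.exp (refTime n)).toNNReal with ht₀
  -- Earlier proportions depend only on the path up to `t₀`, and the `n`-th only on increments after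
  -- `t₀`. The maps `ext` and `back` rebuild full paths from these two independent pieces, with
  -- irrelevant values set to zero, and `obsProportion_congr` shows that nothing is lost.
  let ext : (Iic t₀ → ℝ) → ℝ≥0 → ℝ := fun w t => if h : t ≤ t₀ then w ⟨t, h⟩ else 0
  have hext : Measurable ext := by
    refine measurable_pi_lambda _ fun t => ?_
    by_cases h : t ≤ t₀
    · simp only [ext, h, dite_true]; exact measurable_pi_apply _
    · simp only [ext, h, dite_false]; exact measurable_const
  let back : (ℝ≥0 → ℝ) → ℝ≥0 → ℝ := fun w t => if t ≤ t₀ then 0 else w (t - t₀)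
  have hback : Measurable back := by
    refine measurable_pi_lambda _ fun t => ?_
    by_cases h : t ≤ t₀
    · simp only [back, h, if_true]; exact measurable_const
    · simp only [back, h, if_false]; exact measurable_pi_apply _
  have h := (hB.pre.indepFun_shift t₀).symm.comp
    (φ := fun w => ∑ k ∈ Finset.range n, obsProportion k (ext w))
    (ψ := fun w => obsProportion n (back w))
    (Finset.measurable_fun_sum _ fun k _ => (measurable_obsProportion k).comp hext)
    ((measurable_obsProportion n).comp hback)
  convert h using 1
  · ext ω
    refine Finset.sum_congr rfl fun k hk => obsProportion_congr fun s hs => ?_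
    obtain ⟨h1, h2⟩ := exp_log_toNNReal_bounds hs
    have h3 : (Real.exp (refTime (k + 1))).toNNReal ≤ t₀ := by
      refine Real.toNNReal_le_toNNReal (Real.exp_le_exp.2 ?_)
      exact_mod_cast refTime_mono (Nat.succ_le_of_lt (Finset.mem_range.1 hk))
    simp only [ext]
    rw [dif_pos (h2.trans h3), dif_pos (h1.trans (h2.trans h3))]
  · ext ω
    refine obsProportion_congr fun s hs => ?_
    obtain ⟨h1, -⟩ := exp_log_toNNReal_bounds hs
    simp only [back]
    rw [if_pos le_rfl, sub_zero]
    split_ifs with h2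
    · rw [le_antisymm h2 h1, sub_self]
    · rw [add_tsub_cancel_of_le h1]

lemma IsRegularBrownian.exists_le_integral_obsProportion (hB : IsRegularBrownian B P) :
    ∃ c : ℝ, 0 < c ∧ ∀ k : ℕ, 196 ≤ k →
      c * (1 / ((k : ℝ) * Real.log k)) ≤ ∫ ω, obsProportion k (B · ω) ∂P := by
  have hP : IsProbabilityMeasure P := hB.pre.isGaussianProcess.isProbabilityMeasure
  obtain ⟨c, hc, hinc⟩ := IsRegularBrownian.exists_le_measure_increment
  -- The exponent is `52 = 32/2 + 36`, from `hysq` and `hyg`. The factor `6` bounds the threshold by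
  -- `6 √(log k)`, `14` bounds the shell index, and `4` is the loss in counting the integers of the
  -- window.
  refine ⟨c * Real.exp (-52) / (6 * 14) / 4, by positivity, fun k hk => ?_⟩
  obtain ⟨hlog, hgap, hx1, hx2, hn⟩ := obs_estimates hk
  have hk0 : (0 : ℝ) < k := by exact_mod_cast (by omega : 0 < k)
  set l := Real.log k with hl
  set x := obsLevel k with hx
  have hy1 : 1 ≤ obsThreshold k := by
    rw [obsThreshold]
    have : 0 ≤ 2 * obsLevel k / Real.log k := by positivity
    linarith
  have hy3 : obsThreshold k ≤ 3 * x := by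
    have : 2 * x / l ≤ 2 * x := div_le_self (by linarith) hlog
    rw [obsThreshold]; linarith
  have hysq : obsThreshold k ^ 2 ≤ x ^ 2 + 32 := by
    rw [obsThreshold, ← hx, ← hl]
    have h1 : (x + 2 * x / l) ^ 2 = x ^ 2 + x ^ 2 * (4 / l + 4 / l ^ 2) := by field_simp; ring
    have h2 : 4 / l + 4 / l ^ 2 ≤ 8 / l := by
      have : 4 / l ^ 2 ≤ 4 / l := by
        refine div_le_div_of_nonneg_left (by norm_num) (by linarith) (by nlinarith)
      have h3 : 8 / l = 4 / l + 4 / l := by ring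
      linarith
    have h4 : x ^ 2 * (4 / l + 4 / l ^ 2) ≤ 4 * l * (8 / l) := by gcongr
    have h5 : 4 * l * (8 / l) = 32 := by field_simp; norm_num
    linarith
  have hyg : obsThreshold k ^ 2 * Real.exp (-gap k) ≤ 36 := by
    have h1 : Real.exp (-(gap k : ℝ)) = Real.exp (-gap k / 2) ^ 2 := by
      rw [← Real.exp_nat_mul]; push_cast; ring_nf
    rw [h1]
    calc obsThreshold k ^ 2 * Real.exp (-gap k / 2) ^ 2 ≤ (3 * x) ^ 2 * (1 / l) ^ 2 := by
          gcongr
      _ = 9 * x ^ 2 * (1 / l ^ 2) := by ring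
      _ ≤ 9 * (4 * l) * (1 / l ^ 2) := by gcongr
      _ = 36 / l := by field_simp; norm_num
      _ ≤ 36 := div_le_self (by norm_num) hlog
  have hx2l : x ≤ 2 * √l := by
    rw [← Real.sqrt_sq (by linarith : 0 ≤ x)]
    refine (Real.sqrt_le_sqrt hx2).trans (le_of_eq ?_)
    rw [show (4 : ℝ) * l = 2 ^ 2 * l by ring, Real.sqrt_mul (sq_nonneg 2),
      Real.sqrt_sq (by norm_num)]
  have hn0 : (0 : ℝ) < (refTime k + gap k + 1 : ℕ) := by positivity
  have hxn : Real.exp (-(x ^ 2 / 2)) = 1 / (refTime k + gap k + 1 : ℕ) := by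
    have h1 : x ^ 2 / 2 = Real.log (refTime k + gap k + 1 : ℕ) := by
      rw [hx, obsLevel, Real.sq_sqrt]
      · ring
      · have : (1 : ℝ) ≤ (refTime k + gap k + 1 : ℕ) := by exact_mod_cast Nat.succ_pos _
        have := Real.log_nonneg this
        linarith
    rw [h1, Real.exp_neg, Real.exp_log hn0, one_div]
  have hsqrt0 : 0 < √l := Real.sqrt_pos.2 (by linarith)
  have hp : c * Real.exp (-52) / (6 * 14) * (1 / ((k : ℝ) * l)) ≤ c / obsThreshold k *
      Real.exp (-(obsThreshold k ^ 2 / 2 + obsThreshold k ^ 2 * Real.exp (-gap k))) := by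
    have h1 : Real.exp (-52) * (1 / (14 * k * √l)) ≤
        Real.exp (-(obsThreshold k ^ 2 / 2 + obsThreshold k ^ 2 * Real.exp (-gap k))) := by
      calc Real.exp (-52) * (1 / (14 * k * √l)) ≤
            Real.exp (-52) * (1 / (refTime k + gap k + 1 : ℕ)) := by gcongr
        _ = Real.exp (-52 + -(x ^ 2 / 2)) := by rw [← hxn, Real.exp_add]
        _ ≤ _ := Real.exp_le_exp.2 (by linarith)
    have h2 : c / (6 * √l) ≤ c / obsThreshold k := by
      refine div_le_div_of_nonneg_left hc.le (by linarith) (by linarith)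
    calc c * Real.exp (-52) / (6 * 14) * (1 / ((k : ℝ) * l)) =
          c / (6 * √l) * (Real.exp (-52) * (1 / (14 * k * √l))) := by
            have : l = √l ^ 2 := (Real.sq_sqrt (by linarith)).symm
            rw [this, Real.sqrt_sq hsqrt0.le]
            field_simp
      _ ≤ _ := by gcongr
  have hpath : Measurable fun ω => (fun t => B t ω) := measurable_pi_lambda _ hB.meas
  have hev : ∀ s ∈ obsWindow k, c * Real.exp (-52) / (6 * 14) * (1 / ((k : ℝ) * l)) ≤
      ∫ ω, (incrementEvent k s).indicator (1 : (ℝ≥0 → ℝ) → ℝ) (B · ω) ∂P := by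
    intro s hs
    obtain ⟨h1, h2⟩ := mem_obsWindow hs
    have hs0 : (0 : ℝ) < s := (Real.exp_pos _).trans_le h1
    have h3 : (fun ω => (incrementEvent k s).indicator (1 : (ℝ≥0 → ℝ) → ℝ) (B · ω)) =
        ((fun ω => (fun t => B t ω)) ⁻¹' incrementEvent k s).indicator 1 := by
      ext ω; rfl
    rw [h3, integral_indicator_one (hpath (measurableSet_incrementEvent k s))]
    refine hp.trans ?_
    rw [measureReal_def, ← ENNReal.ofReal_le_iff_le_toReal (measure_ne_top _ _)]
    refine hinc hB (Real.log s) (refTime k) (gap k) _ ?_ ?_ hy1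
    · exact_mod_cast (by rw [gap]; omega : 1 ≤ gap k)
    · rw [Real.le_log_iff_exp_le hs0]
      exact_mod_cast h1
  have hint : ∀ s ∈ obsWindow k, Integrable
      (fun ω => (incrementEvent k s).indicator (1 : (ℝ≥0 → ℝ) → ℝ) (B · ω)) P := by
    intro s _
    refine Integrable.of_bound (((measurable_one.indicator
      (measurableSet_incrementEvent k s)).comp hpath).aestronglyMeasurable) 1 (.of_forall ?_)
    intro ω
    refine (norm_indicator_le_norm_self _ _).trans (by simp)
  simp only [obsProportion]
  rw [integral_div, integral_finsetSum _ hint, le_div_iff₀ (Real.exp_pos _)]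
  calc c * Real.exp (-52) / (6 * 14) / 4 * (1 / ((k : ℝ) * l)) *
        Real.exp (refTime k + gap k + 1 : ℕ) =
        (Real.exp (refTime k + gap k + 1 : ℕ) / 4) *
          (c * Real.exp (-52) / (6 * 14) * (1 / ((k : ℝ) * l))) := by ring
    _ ≤ (obsWindow k).card * (c * Real.exp (-52) / (6 * 14) * (1 / ((k : ℝ) * l))) := by
        gcongr
        exact le_card_obsWindow k
    _ ≤ _ := by
        rw [← nsmul_eq_mul]
        exact Finset.card_nsmul_le_sum _ _ _ hev

lemma IsRegularBrownian.ae_tsum_obsProportion (hB : IsRegularBrownian B P) :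
    ∀ᵐ ω ∂P, ∑' k, ENNReal.ofReal (obsProportion k (B · ω)) = ∞ := by
  have hP : IsProbabilityMeasure P := hB.pre.isGaussianProcess.isProbabilityMeasure
  have hpath : Measurable fun ω => (fun t => B t ω) := measurable_pi_lambda _ hB.meas
  refine ae_tsum_ofReal_eq_top (fun k => (measurable_obsProportion k).comp hpath)
    (fun k ω => obsProportion_nonneg k _) (fun k ω => obsProportion_le_one k _)
    hB.indepFun_obsProportion ?_
  obtain ⟨c, hc, h⟩ := hB.exists_le_integral_obsProportion
  have hge : ∀ n : ℕ, c * (∑ k ∈ Finset.range n, 1 / ((k : ℝ) * Real.log k)) -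
      c * (∑ k ∈ Finset.range 196, 1 / ((k : ℝ) * Real.log k)) ≤
      ∑ k ∈ Finset.range n, ∫ ω, obsProportion k (B · ω) ∂P := by
    intro n
    have hnn : ∀ k : ℕ, 0 ≤ 1 / ((k : ℝ) * Real.log k) := fun k =>
      one_div_nonneg.2 (mul_nonneg (by positivity) (Real.log_natCast_nonneg k))
    have hI : ∀ k, 0 ≤ ∫ ω, obsProportion k (B · ω) ∂P := fun k =>
      integral_nonneg fun ω => obsProportion_nonneg k _
    induction n with
    | zero =>
      simp only [Finset.range_zero, Finset.sum_empty, mul_zero, zero_sub, neg_nonpos]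
      exact mul_nonneg hc.le (Finset.sum_nonneg fun k _ => hnn k)
    | succ n ih =>
      rcases Nat.lt_or_ge n 196 with hn | hn
      · have h1 : ∑ k ∈ Finset.range (n + 1), 1 / ((k : ℝ) * Real.log k) ≤
            ∑ k ∈ Finset.range 196, 1 / ((k : ℝ) * Real.log k) :=
          Finset.sum_le_sum_of_subset_of_nonneg (Finset.range_subset_range.2 hn)
            fun k _ _ => hnn k
        have h2 := mul_le_mul_of_nonneg_left h1 hc.le
        have h3 : 0 ≤ ∑ k ∈ Finset.range (n + 1), ∫ ω, obsProportion k (B · ω) ∂P :=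
          Finset.sum_nonneg fun k _ => hI k
        linarith
      · rw [Finset.sum_range_succ _ n, Finset.sum_range_succ _ n, mul_add]
        linarith [h n hn]
  refine tendsto_atTop_mono hge ?_
  exact tendsto_atTop_add_const_right _ _ (tendsto_sum_one_div_mul_log.const_mul_atTop hc)

lemma IsRegularBrownian.one_le_macroDim (hB : IsRegularBrownian B P) :
    ∀ᵐ ω ∂P, ∀ E : Set ℝ,
      (∀ᶠ s in atTop, √(2 * Real.log (Real.log s)) ≤ ouProcess B (Real.log s) ω → s ∈ E) →
      1 ≤ macroDim E := by
  classical
  filter_upwards [hB.ae_tsum_obsProportion, hB.eventually_abs_ouProcess_lt one_lt_two]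
    with ω hω hup E hE
  refine one_le_macroDim_of_count (fun k => refTime k + gap k) strictMono_refTime_add_gap.injective
    (fun k => (obsWindow k).filter fun s => (B · ω) ∈ incrementEvent k s)
    (fun k s hs => mem_obsWindow (Finset.mem_filter.1 hs).1) ?_ ?_
  · have hidx : Tendsto (fun k => (refTime k : ℝ)) atTop atTop :=
      tendsto_natCast_atTop_atTop.comp (tendsto_atTop_mono le_refTime tendsto_id)
    obtain ⟨R, hR⟩ := eventually_atTop.1 hE
    filter_upwards [hidx.eventually hup, hidx.eventually_ge_atTop R, eventually_ge_atTop 196]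
      with k h1 h2 h3 s hs
    obtain ⟨hsw, hinc⟩ := Finset.mem_filter.1 hs
    obtain ⟨h4, h5⟩ := mem_obsWindow hsw
    obtain ⟨hlog, hgap, hx1, -, -⟩ := obs_estimates h3
    have hs0 : (0 : ℝ) < s := (Real.exp_pos _).trans_le h4
    have hk : (196 : ℝ) ≤ k := by exact_mod_cast h3
    have hkr : (k : ℝ) ≤ refTime k := by exact_mod_cast le_refTime k
    have hls : ((refTime k + gap k : ℕ) : ℝ) ≤ Real.log s := (Real.le_log_iff_exp_le hs0).2 h4
    have hls2 : Real.log s < (refTime k + gap k + 1 : ℕ) := (Real.log_lt_iff_lt_exp hs0).2 h5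
    have hcast : ((refTime k + gap k : ℕ) : ℝ) = refTime k + gap k := by push_cast; ring
    have hg0 : (0 : ℝ) ≤ gap k := by positivity
    refine hR s ?_ ?_
    · have := Real.log_le_sub_one_of_pos hs0
      linarith
    -- The surplus `2 * obsLevel k / log k` in the threshold exactly pays for the damped value at
    -- the reference time, since the gap makes the damping at most `1 / log k`.
    · have hb : |(ouProcess B (refTime k) ω)| ≤ 2 * obsLevel k := by
        refine h1.le.trans ?_
        rw [obsLevel]
        gcongr
        · linarith
        · omega
      have hU := le_ouProcess_of_increment hinc hb
      have hsmall : Real.exp (-(Real.log s - refTime k) / 2) * (2 * obsLevel k) ≤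
          2 * obsLevel k / Real.log k := by
        calc Real.exp (-(Real.log s - refTime k) / 2) * (2 * obsLevel k) ≤
              (1 / Real.log k) * (2 * obsLevel k) := by
                gcongr
                exact (Real.exp_le_exp.2 (by linarith)).trans hgap
          _ = _ := by ring
      have hlev : √(2 * Real.log (Real.log s)) ≤ obsLevel k := by
        rw [obsLevel]
        gcongr
        linarith
      rw [obsThreshold] at hU
      linarith
  · rw [← hω]
    refine tsum_congr fun k => ?_
    rw [obsProportion, Finset.card_filter]
    push_cast
    rfl

/-! ### Gauge functions and the main theorem -/

lemma isBounded_of_eventually_notMem {E : Set ℝ} {a : ℝ} (ha : ∀ s ∈ E, a ≤ s)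
    (h : ∀ᶠ s in atTop, s ∉ E) : Bornology.IsBounded E := by
  obtain ⟨R, hR⟩ := eventually_atTop.1 h
  refine (Metric.isBounded_Icc a R).subset fun s hs => ⟨ha s hs, ?_⟩
  by_contra! hlt
  exact hR s hlt.le hs

lemma limsup_coe_eq_one {f : ℝ → ℝ} (hle : ∀ γ : ℝ, 1 < γ → ∀ᶠ s in atTop, f s ≤ γ)
    (hge : ∃ᶠ s in atTop, 1 ≤ f s) : limsup (fun s => (f s : EReal)) atTop = 1 := by
  refine le_antisymm ?_ ?_
  · by_contra! hlt
    obtain ⟨γ, h1, h2⟩ := EReal.lt_iff_exists_real_btwn.1 hlt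
    refine absurd h2 (not_lt.2 (limsup_le_of_le (h := ?_)))
    filter_upwards [hle γ (by exact_mod_cast h1)] with s hs
    exact_mod_cast hs
  · refine le_limsup_of_frequently_le (hge.mono fun s hs => ?_)
    exact_mod_cast hs

lemma eq_sqrt_mul_ouProcess_log {s : ℝ} (hs : 0 < s) (ω : Ω) :
    B s.toNNReal ω = √s * ouProcess B (Real.log s) ω := by
  rw [ouProcess, Real.exp_log hs, ← mul_assoc, Real.sqrt_eq_rpow, Real.rpow_def_of_pos hs,
    ← Real.exp_add]
  ring_nf
  simp

lemma div_sqrt_eq_ouProcess {s : ℝ} (hs : 0 < s) (L : ℝ) (ω : Ω) :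
    B s.toNNReal ω / √(2 * s * L) = ouProcess B (Real.log s) ω / √(2 * L) := by
  have h1 : √(2 * s * L) = √s * √(2 * L) := by
    rw [← Real.sqrt_mul hs.le]; ring_nf
  rw [h1, eq_sqrt_mul_ouProcess_log (B := B) hs ω, mul_div_mul_left _ _ (Real.sqrt_pos.2 hs).ne']

lemma posLog_posLog_eq {s : ℝ} (hs : Real.exp 1 ≤ s) :
    Real.posLog (Real.posLog s) = Real.log (Real.log s) := by
  have h0 : 0 < s := (Real.exp_pos 1).trans_le hs
  have h1 : 1 ≤ Real.log s := (Real.le_log_iff_exp_le h0).2 hs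
  have h2 : 1 ≤ s := (Real.one_le_exp zero_le_one).trans hs
  rw [Real.posLog_eq_log (x := s) (by rw [abs_of_pos h0]; exact h2),
    Real.posLog_eq_log (by rw [abs_of_pos] <;> linarith)]

lemma abs_div_gauge_eq {s : ℝ} (hs : Real.exp 1 ≤ s) (ω : Ω) :
    |B s.toNNReal ω| / √(2 * s * Real.posLog (Real.posLog s)) =
      |(ouProcess B (Real.log s) ω)| / √(2 * Real.log (Real.log s)) := by
  have h0 : 0 < s := (Real.exp_pos 1).trans_le hs
  rw [posLog_posLog_eq hs, ← abs_of_nonneg (Real.sqrt_nonneg (2 * s * Real.log (Real.log s))),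
    ← abs_div, div_sqrt_eq_ouProcess h0, abs_div, abs_of_nonneg (Real.sqrt_nonneg _)]

lemma eventually_sqrt_log_pos : ∀ᶠ u : ℝ in atTop, 0 < √(2 * Real.log u) := by
  filter_upwards [eventually_gt_atTop 1] with u hu
  have := Real.log_pos hu
  positivity

/-- Levels `1 + 1/(m+1)` suffice, so a single null set serves all `γ > 1`. -/
lemma IsRegularBrownian.ae_forall_eventually_lt (hB : IsRegularBrownian B P) :
    ∀ᵐ ω ∂P, ∀ γ : ℝ, 1 < γ → ∀ᶠ s : ℝ in atTop,
      |(ouProcess B s ω)| / √(2 * Real.log s) < γ := by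
  have h := ae_all_iff.2 fun m : ℕ => hB.eventually_abs_ouProcess_lt (γ := 1 + 1 / ((m : ℝ) + 1))
    (by have : (0 : ℝ) < 1 / ((m : ℝ) + 1) := by positivity
        linarith)
  filter_upwards [h] with ω hω γ hγ
  obtain ⟨m, hm⟩ := exists_nat_one_div_lt (sub_pos.2 hγ)
  filter_upwards [hω m, eventually_sqrt_log_pos] with s h1 h2
  rw [div_lt_iff₀ h2]
  refine h1.trans_le ?_
  gcongr
  linarith

/-- The lower half of the law of the iterated logarithm comes from the dimension bound at the
critical level: were the level eventually not reached, the bound would apply to the empty set, whose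
dimension is `0`. -/
lemma IsRegularBrownian.ae_frequently_le (hB : IsRegularBrownian B P) :
    ∀ᵐ ω ∂P, ∃ᶠ s : ℝ in atTop,
      1 ≤ |(ouProcess B (Real.log s) ω)| / √(2 * Real.log (Real.log s)) := by
  filter_upwards [hB.one_le_macroDim] with ω hω
  by_contra hcon
  rw [not_frequently] at hcon
  have h := hω ∅ ?_
  · rw [macroDim_eq_zero_of_isBounded Bornology.isBounded_empty] at h
    exact absurd h (by simp)
  · filter_upwards [hcon, Real.tendsto_log_atTop.eventually eventually_sqrt_log_pos]
      with s h1 h2 h3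
    refine absurd ?_ h1
    rw [one_le_div h2]
    exact h3.trans (le_abs_self _)

lemma IsRegularBrownian.one_sub_sq_le_macroDim (hB : IsRegularBrownian B P) {γ : ℝ} (hγ : 0 < γ) :
    ∀ᵐ ω ∂P, ∀ E : Set ℝ,
      (∀ᶠ s in atTop, γ * √(2 * Real.log s) ≤ ouProcess B s ω → s ∈ E) →
      ENNReal.ofReal (1 - γ ^ 2) ≤ macroDim E := by
  have hm : ∀ m : ℕ, (0 : ℝ) < 1 / ((m : ℝ) + 1) := fun m => by positivity
  have := ae_all_iff.2 fun m : ℕ => hB.le_macroDim (θ := γ ^ 2 + 1 / ((m : ℝ) + 1)) hγ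
    (by linarith [hm m])
  filter_upwards [this] with ω hω E hE
  have hlim : Tendsto (fun m : ℕ => ENNReal.ofReal (1 - (γ ^ 2 + 1 / ((m : ℝ) + 1)))) atTop
      (nhds (ENNReal.ofReal (1 - (γ ^ 2 + 0)))) :=
    ENNReal.tendsto_ofReal
      (((tendsto_one_div_add_atTop_nhds_zero_nat (𝕜 := ℝ)).const_add (γ ^ 2)).const_sub 1)
  rw [add_zero] at hlim
  exact le_of_tendsto' hlim fun m => hω m E hE

lemma IsRegularBrownian.isGauge_self (hB : IsRegularBrownian B P) :
    IsGauge (fun s => √(2 * s * Real.posLog (Real.posLog s))) (fun s => B s.toNNReal) P where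
  nonneg _ _ := Real.sqrt_nonneg _
  monotoneOn := by
    intro a ha b _ hab
    have ha' : 0 ≤ a := ha
    refine Real.sqrt_le_sqrt (mul_le_mul (by linarith) ?_ Real.posLog_nonneg (by linarith))
    exact Real.posLog_le_posLog Real.posLog_nonneg (Real.posLog_le_posLog ha' hab)
  tendsto := by
    refine Real.tendsto_sqrt_atTop.comp ?_
    have h1 : Tendsto (fun s : ℝ => Real.log (Real.log s)) atTop atTop :=
      Real.tendsto_log_atTop.comp Real.tendsto_log_atTop
    refine Tendsto.congr' ?_ ((tendsto_id.const_mul_atTop two_pos).atTop_mul_atTop₀ h1)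
    filter_upwards [eventually_ge_atTop (Real.exp 1)] with s hs
    rw [posLog_posLog_eq hs]
    rfl
  limsup_eq := by
    filter_upwards [hB.ae_forall_eventually_lt, hB.ae_frequently_le] with ω h1 h2
    refine limsup_coe_eq_one (fun γ hγ => ?_) ?_
    · filter_upwards [Real.tendsto_log_atTop.eventually (h1 γ hγ),
        eventually_ge_atTop (Real.exp 1)] with s h3 h4
      rw [abs_div_gauge_eq h4]
      exact h3.le
    · refine (h2.and_eventually (eventually_ge_atTop (Real.exp 1))).mono fun s hs => ?_
      rw [abs_div_gauge_eq hs.2]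
      exact hs.1

lemma IsRegularBrownian.isGauge_ouProcess (hB : IsRegularBrownian B P) :
    IsGauge (fun s => √(2 * Real.posLog s)) (ouProcess B) P where
  nonneg _ _ := Real.sqrt_nonneg _
  monotoneOn := by
    intro a ha b _ hab
    exact Real.sqrt_le_sqrt (mul_le_mul_of_nonneg_left (Real.posLog_le_posLog ha hab) zero_le_two)
  tendsto := by
    refine Real.tendsto_sqrt_atTop.comp (Tendsto.const_mul_atTop two_pos ?_)
    refine Tendsto.congr' ?_ Real.tendsto_log_atTop
    filter_upwards [eventually_ge_atTop 1] with s hs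
    rw [Real.posLog_eq_log (hs.trans (le_abs_self s))]
  limsup_eq := by
    filter_upwards [hB.ae_forall_eventually_lt, hB.ae_frequently_le] with ω h1 h2
    refine limsup_coe_eq_one (fun γ hγ => ?_) ?_
    · filter_upwards [h1 γ hγ, eventually_ge_atTop 1] with s h3 h4
      rw [Real.posLog_eq_log (h4.trans (le_abs_self s))]
      exact h3.le
    · refine ((Real.tendsto_log_atTop.frequently (p := fun u =>
        1 ≤ |(ouProcess B u ω)| / √(2 * Real.log u)) h2).and_eventually
        (eventually_ge_atTop 1)).mono fun s hs => ?_
      rw [Real.posLog_eq_log (hs.2.trans (le_abs_self s))]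
      exact hs.1

lemma IsRegularBrownian.isMonofractal (hB : IsRegularBrownian B P) (c₀ : ℝ) :
    IsMonofractal (fun s => √(2 * s * Real.posLog (Real.posLog s)))
      (fun s => B s.toNNReal) c₀ P := by
  refine ⟨hB.isGauge_self, ?_⟩
  filter_upwards [hB.ae_forall_eventually_lt, hB.one_le_macroDim] with ω h1 h2 γ _
  refine ⟨fun hγ => le_antisymm (macroDim_le_one _) (h2 _ ?_), fun hγ => ?_⟩
  · filter_upwards [eventually_gt_atTop c₀, eventually_ge_atTop (Real.exp 1),
      Real.tendsto_log_atTop.eventually eventually_sqrt_log_pos] with s h3 h4 h5 h6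
    refine ⟨h3, ?_⟩
    rw [abs_div_gauge_eq h4]
    exact hγ.trans_le ((one_le_div h5).2 (h6.trans (le_abs_self _)))
  · refine macroDim_eq_zero_of_isBounded (isBounded_of_eventually_notMem (a := c₀)
      (fun s hs => hs.1.le) ?_)
    filter_upwards [Real.tendsto_log_atTop.eventually (h1 γ hγ),
      eventually_ge_atTop (Real.exp 1)] with s h3 h4 h5
    have h6 := h5.2
    rw [abs_div_gauge_eq h4] at h6
    exact lt_asymm h3 h6

lemma IsRegularBrownian.isMultifractal (hB : IsRegularBrownian B P) {c₀ : ℝ} (hc₀ : 0 < c₀) :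
    IsMultifractal (fun s => √(2 * Real.posLog s)) (ouProcess B) c₀ P := by
  let γ : ℕ → ℝ := fun i => 1 / ((i : ℝ) + 2)
  have hanti : StrictAnti γ := strictAnti_nat_of_succ_lt fun i => by
    simp only [γ]; push_cast; gcongr; linarith
  have hpos : ∀ i, 0 < γ i := fun i => by simp only [γ]; positivity
  have hle : ∀ i, γ i < 1 := fun i => by
    simp only [γ]
    rw [div_lt_one (by positivity)]
    have : (0 : ℝ) ≤ i := by positivity
    linarith
  refine ⟨hB.isGauge_ouProcess, γ, hanti, hpos, ?_⟩
  -- A level strictly between consecutive scales: reaching `η i` implies strictly exceeding `γ (i +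
  -- 1)`, and `1 - (γ i)² < 1 - (η i)²` separates the upper bound at `γ i` from the lower bound at
  -- `γ (i + 1)`.
  let η : ℕ → ℝ := fun i => (γ i + γ (i + 1)) / 2
  have hη1 : ∀ i, η i < γ i := fun i => by
    have := hanti (Nat.lt_succ_self i); simp only [η]; linarith
  have hη2 : ∀ i, γ (i + 1) < η i := fun i => by
    have := hanti (Nat.lt_succ_self i); simp only [η]; linarith
  have hη0 : ∀ i, 0 < η i := fun i => (hpos _).trans (hη2 i)
  filter_upwards [ae_all_iff.2 fun i => hB.macroDim_le (hpos i) (hle i).le,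
    ae_all_iff.2 fun i => hB.one_sub_sq_le_macroDim (hη0 i)] with ω h1 h2 i
  have hup := h1 i (tallPeaks (fun s => √(2 * Real.posLog s)) (ouProcess B) c₀ (γ i) ω)
    (fun s hs => hc₀.le.trans hs.1.le) ?_
  · have hlo := h2 i (tallPeaks (fun s => √(2 * Real.posLog s)) (ouProcess B) c₀ (γ (i + 1)) ω) ?_
    · refine hup.trans_lt (lt_of_lt_of_le ?_ hlo)
      have h3 := hη1 i
      have h4 := hη0 i
      have h5 := hle i
      rw [ENNReal.ofReal_lt_ofReal_iff (by nlinarith)]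
      nlinarith
    · filter_upwards [eventually_gt_atTop c₀, eventually_ge_atTop 1, eventually_sqrt_log_pos]
        with s h3 h4 h5 h6
      refine ⟨h3, ?_⟩
      beta_reduce
      rw [Real.posLog_eq_log (h4.trans (le_abs_self s))]
      exact (hη2 i).trans_le ((le_div_iff₀ h5).2 (h6.trans (le_abs_self _)))
  · filter_upwards [eventually_ge_atTop 1, eventually_sqrt_log_pos] with s h4 h5 h6
    have h7 := h6.2
    beta_reduce at h7
    rw [Real.posLog_eq_log (h4.trans (le_abs_self s))] at h7
    exact ((lt_div_iff₀ h5).1 h7).le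

lemma IsRegularBrownian.macroDim_brownian_eq (hB : IsRegularBrownian B P) (γ : ℝ) :
    ∀ᵐ ω ∂P, macroDim {s : ℝ | Real.exp (Real.exp 1) ≤ s ∧
      γ ≤ B s.toNNReal ω / √(2 * s * Real.log (Real.log s))} = if γ ≤ 1 then 1 else 0 := by
  filter_upwards [hB.ae_forall_eventually_lt, hB.one_le_macroDim] with ω h1 h2
  split_ifs with hγ
  · refine le_antisymm (macroDim_le_one _) (h2 _ ?_)
    filter_upwards [eventually_ge_atTop (Real.exp (Real.exp 1)), eventually_gt_atTop 0,
      Real.tendsto_log_atTop.eventually eventually_sqrt_log_pos] with s h3 h4 h5 h6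
    refine ⟨h3, ?_⟩
    rw [div_sqrt_eq_ouProcess h4]
    exact hγ.trans ((one_le_div h5).2 h6)
  · refine macroDim_eq_zero_of_isBounded (isBounded_of_eventually_notMem (fun s hs => hs.1) ?_)
    filter_upwards [Real.tendsto_log_atTop.eventually (h1 γ (not_le.1 hγ)),
      eventually_gt_atTop 0] with s h3 h4 h5
    have h6 := h5.2
    rw [div_sqrt_eq_ouProcess h4] at h6
    refine absurd (h6.trans ?_) (not_le.2 h3)
    gcongr
    exact le_abs_self _

lemma IsRegularBrownian.macroDim_ouProcess_eq (hB : IsRegularBrownian B P) {γ : ℝ} (hγ : 0 < γ) :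
    ∀ᵐ ω ∂P,
      (γ ≤ 1 → macroDim {s : ℝ | Real.exp (Real.exp 1) ≤ s ∧
        γ ≤ ouProcess B s ω / √(2 * Real.log s)} = ENNReal.ofReal (1 - γ ^ 2)) ∧
      (1 < γ → Bornology.IsBounded {s : ℝ | Real.exp (Real.exp 1) ≤ s ∧
        γ ≤ ouProcess B s ω / √(2 * Real.log s)}) := by
  have hup : ∀ᵐ ω ∂P, γ ≤ 1 → ∀ E : Set ℝ, (∀ s ∈ E, 0 ≤ s) →
      (∀ᶠ s in atTop, s ∈ E → γ * √(2 * Real.log s) ≤ |(ouProcess B s ω)|) →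
      macroDim E ≤ ENNReal.ofReal (1 - γ ^ 2) := by
    by_cases hγ1 : γ ≤ 1
    · filter_upwards [hB.macroDim_le hγ hγ1] with ω h _ using h
    · exact .of_forall fun ω h => absurd h hγ1
  filter_upwards [hB.ae_forall_eventually_lt, hup, hB.one_sub_sq_le_macroDim hγ] with ω h1 h2 h3
  refine ⟨fun hγ1 => le_antisymm (h2 hγ1 _ (fun s hs => (Real.exp_pos _).le.trans hs.1) ?_)
    (h3 _ ?_), fun hγ1 => isBounded_of_eventually_notMem (fun s hs => hs.1) ?_⟩
  · filter_upwards [eventually_sqrt_log_pos] with s h4 h5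
    exact ((le_div_iff₀ h4).1 h5.2).trans (le_abs_self _)
  · filter_upwards [eventually_sqrt_log_pos, eventually_ge_atTop (Real.exp (Real.exp 1))]
      with s h4 h5 h6
    exact ⟨h5, (le_div_iff₀ h4).2 h6⟩
  · filter_upwards [h1 γ hγ1] with s h4 h5
    refine absurd (h5.2.trans ?_) (not_le.2 h4)
    gcongr
    exact le_abs_self _

lemma IsGauge.congr {g : ℝ → ℝ} {X Y : ℝ → Ω → ℝ} (h : IsGauge g X P)
    (hXY : ∀ᵐ ω ∂P, ∀ t, X t ω = Y t ω) : IsGauge g Y P where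
  nonneg := h.nonneg
  monotoneOn := h.monotoneOn
  tendsto := h.tendsto
  limsup_eq := by
    filter_upwards [h.limsup_eq, hXY] with ω h1 h2
    simpa only [h2] using h1

lemma IsMonofractal.congr {g : ℝ → ℝ} {X Y : ℝ → Ω → ℝ} {c₀ : ℝ} (h : IsMonofractal g X c₀ P)
    (hXY : ∀ᵐ ω ∂P, ∀ t, X t ω = Y t ω) : IsMonofractal g Y c₀ P := by
  refine ⟨h.1.congr hXY, ?_⟩
  filter_upwards [h.2, hXY] with ω h1 h2
  simpa only [tallPeaks, h2] using h1

lemma IsMultifractal.congr {g : ℝ → ℝ} {X Y : ℝ → Ω → ℝ} {c₀ : ℝ} (h : IsMultifractal g X c₀ P)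
    (hXY : ∀ᵐ ω ∂P, ∀ t, X t ω = Y t ω) : IsMultifractal g Y c₀ P := by
  obtain ⟨h0, γ, hγ, hγ0, h⟩ := h
  refine ⟨h0.congr hXY, γ, hγ, hγ0, ?_⟩
  filter_upwards [h, hXY] with ω h1 h2
  simpa only [tallPeaks, h2] using h1

end MacroFractal

theorem theoremB {Ω : Type*} {mΩ : MeasurableSpace Ω} (P : Measure Ω) [IsProbabilityMeasure P]
    (B : ℝ≥0 → Ω → ℝ) (hB : IsBrownianReal B P) :
    -- the tall peaks of `B` are monofractal, those of `U` are multifractal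
    (∀ c₀ : ℝ, 0 < c₀ →
      MacroFractal.IsMonofractal (fun s => √(2 * s * Real.posLog (Real.posLog s)))
        (fun s => B s.toNNReal) c₀ P ∧
      MacroFractal.IsMultifractal (fun s => √(2 * Real.posLog s))
        (MacroFractal.ouProcess B) c₀ P) ∧
    -- the precise dimensions
    (∀ γ : ℝ, 0 < γ →
      (∀ᵐ ω ∂P,
        MacroFractal.macroDim {s : ℝ | Real.exp (Real.exp 1) ≤ s ∧
          γ ≤ B s.toNNReal ω / √(2 * s * Real.log (Real.log s))} = if γ ≤ 1 then 1 else 0) ∧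
      (∀ᵐ ω ∂P,
        (γ ≤ 1 → MacroFractal.macroDim {s : ℝ | Real.exp (Real.exp 1) ≤ s ∧
          γ ≤ MacroFractal.ouProcess B s ω / √(2 * Real.log s)} = ENNReal.ofReal (1 - γ ^ 2)) ∧
        (1 < γ → Bornology.IsBounded {s : ℝ | Real.exp (Real.exp 1) ≤ s ∧
          γ ≤ MacroFractal.ouProcess B s ω / √(2 * Real.log s)}))) := by
  -- All claims concern almost every path, so they transfer from a regular process agreeing with `B`
  -- at all times simultaneously.
  obtain ⟨W, hW, hBW⟩ := MacroFractal.exists_isRegularBrownian hB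
  have hX : ∀ᵐ ω ∂P, ∀ t : ℝ, W t.toNNReal ω = B t.toNNReal ω := by
    filter_upwards [hBW] with ω h t using (h _).symm
  have hU : ∀ᵐ ω ∂P, ∀ t : ℝ, MacroFractal.ouProcess W t ω = MacroFractal.ouProcess B t ω := by
    filter_upwards [hBW] with ω h t
    simp only [MacroFractal.ouProcess, h]
  refine ⟨fun c₀ hc₀ => ⟨(hW.isMonofractal c₀).congr hX, (hW.isMultifractal hc₀).congr hU⟩,
    fun γ hγ => ⟨?_, ?_⟩⟩
  · filter_upwards [hW.macroDim_brownian_eq γ, hX] with ω h1 h2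
    simpa only [h2] using h1
  · filter_upwards [hW.macroDim_ouProcess_eq hγ, hU] with ω h1 h2
    simpa only [h2] using h1
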